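/- Let $V$ be a finite vertex set and let $\mathfrak U$ be the set of decomposable undirected graphs on $V$. (A graph is decomposable if it is complete, or if it has a proper decomposition $(A,B)$ such that the induced subgraphs on $A$ and on $B$ are decomposable.) For a graph $G$ and $A\subseteq V$, write $G_A$ for the induced subgraph on $A$. A clique is a maximal complete vertex set. A pair $(A,B)$ of subsets of $V$ with $A\cup B=V$ is called a covering pair; it is a decomposition of $G$ if $A\cap B$ is complete in $G$ and separates $A\setminus B$ from $B\setminus A$, and the decomposition is proper if $A\setminus B$ and $B\setminus A$ are both non-empty. A junction tree of $G$ is a tree whose vertices are the cliques of $G$ such that, for every $A\subseteq V$, the cliques containing $A$ form a connected (possibly empty) subtree; the multiset $\mathcal S(G)$ of separators consists of the intersections $C\cap D$ over the links $\{C,D\}$ of a junction tree, with multiplicity and with empty separators allowed (for $G\in\mathfrak U$ it does not depend on the junction tree). **Theorem 1.** Let $\mathfrak G$ be a probability law on $\mathfrak U$ with density $\pi$ such that $\pi(G)>0$ for every $G\in\mathfrak U$. Then the following are equivalent. 1. $\mathfrak G$ is weakly structurally Markov: for every covering pair $(A,B)$, the random graphs $G_A$ and $G_B$ are independent under $\mathfrak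 G$ conditioned on the event $\mathfrak U^\star(A,B)$ that $(A,B)$ is a decomposition of $G$ and $A\cap B$ is a clique of $G_A$ (nothing is required when this event is empty). 2. $\mathfrak G$ is a clique–separator factorisation law: there are positive real parameters $(\phi_A)_{A\subseteq V}$ and $(\psi_A)_{A\subseteq V}$ such that, over all $G\in\mathfrak U$, $$\pi(G)\;\propto\;\frac{\prod_{C\text{ clique of }G}\phi_C}{\prod_{S\in\mathcal S(G)}\psi_S}.$$ -/

import Mathlib

namespace GraphLaw

/-- `(A, B)` is a decomposition of the induced subgraph `G_W`: it covers `W`, `A ∩ B` is complete,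
and `A ∩ B` separates `A \ B` from `B \ A`, that is, every walk of `G_W` from `A \ B` to `B \ A`
passes through `A ∩ B`. -/
structure IsDecompositionOf {V : Type*} (G : SimpleGraph V) (W A B : Set V) : Prop where
  cover : A ∪ B = W
  complete : G.IsClique (A ∩ B)
  separates : ∀ a ∈ A \ B, ∀ b ∈ B \ A, ∀ p : G.Walk a b,
    (∀ v ∈ p.support, v ∈ W) → ∃ v ∈ p.support, v ∈ A ∩ B

/-- The induced subgraph `G_W` is decomposable: it is complete, or it has a proper decomposition
`(A, B)` such that `G_A` and `G_B` are decomposable. -/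
inductive IsDecomposableOn {V : Type*} (G : SimpleGraph V) : Set V → Prop
  | complete {W : Set V} (h : G.IsClique W) : IsDecomposableOn G W
  | decompose {W A B : Set V} (h : IsDecompositionOf G W A B)
      (hA : (A \ B).Nonempty) (hB : (B \ A).Nonempty)
      (dA : IsDecomposableOn G A) (dB : IsDecomposableOn G B) : IsDecomposableOn G W

/-- A graph is decomposable. -/
def IsDecomposable {V : Type*} (G : SimpleGraph V) : Prop := IsDecomposableOn G Set.univ

/-- The set `𝔘` of decomposable graphs on `V`. -/
abbrev DecomposableGraph (V : Type*) : Type _ := {G : SimpleGraph V // IsDecomposable G}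

/-- The event `𝔘⋆(A, B)`: `(A, B)` is a decomposition of `G` and `A ∩ B` is a clique (a maximal
complete set) of the induced subgraph `G_A`. -/
def weakEvent {V : Type*} (A B : Set V) : Set (DecomposableGraph V) :=
  {G | IsDecompositionOf G.1 Set.univ A B ∧
    Maximal (G.1.induce A).IsClique {v : A | (v : V) ∈ B}}

/-- The weak structural Markov property of a graph law `P`: for every covering pair `(A, B)`, the
random graphs `G_A` and `G_B` are independent under `P` conditioned on the event `𝔘⋆(A, B)`. If that
event has probability zero, the conditioned measure is `0` and nothing is required. -/
def IsWeaklyStructurallyMarkov {V : Type*}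
    (P : MeasureTheory.Measure (DecomposableGraph V)) : Prop :=
  ∀ A B : Set V, A ∪ B = Set.univ →
    ProbabilityTheory.IndepFun
      (fun G : DecomposableGraph V => G.1.induce A)
      (fun G : DecomposableGraph V => G.1.induce B)
      (ProbabilityTheory.cond P (weakEvent A B))

/-- The cliques (maximal complete vertex sets) of `G`. -/
abbrev MaxClique {V : Type*} (G : SimpleGraph V) : Type _ := {C : Set V // Maximal G.IsClique C}

noncomputable instance instFintypeMaxClique {V : Type*} [Finite V] (G : SimpleGraph V) :
    Fintype (MaxClique G) := Fintype.ofFinite _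

/-- A junction tree of `G`: a tree `T` on the cliques of `G` such that, for every vertex set `A`, the
cliques containing `A` induce a connected (possibly empty) subtree of `T`. -/
structure IsJunctionTree {V : Type*} (G : SimpleGraph V) (T : SimpleGraph (MaxClique G)) :
    Prop where
  isTree : T.IsTree
  connected : ∀ A : Set V, (T.induce {C : MaxClique G | A ⊆ C.1}).Preconnected

/-- The separator carried by a link of a junction tree: the intersection of its two cliques. -/
def linkSeparator {V : Type*} {G : SimpleGraph V} (e : Sym2 (MaxClique G)) : Set V :=
  Sym2.lift ⟨fun C D => C.1 ∩ D.1, fun C D => Set.inter_comm C.1 D.1⟩ e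

/-- The multiset of separators read off the links of `T`, one for each link. Empty separators are
allowed. -/
noncomputable def separators {V : Type*} [Finite V] {G : SimpleGraph V}
    (T : SimpleGraph (MaxClique G)) : Multiset (Set V) :=
  T.edgeSet.toFinite.toFinset.val.map linkSeparator

/-- `P` is a clique--separator factorisation law: there are positive set-indexed parameters `φ`, `ψ`
such that `P {G}` is proportional, over all decomposable graphs `G`, to the product of `φ` over the
cliques of `G` divided by the product of `ψ` over the multiset of separators of `G`. The multiset of
separators of a decomposable graph may be computed from any of its junction trees. -/
def IsCliqueSeparatorFactorisationLaw {V : Type*} [Finite V]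
    (P : MeasureTheory.Measure (DecomposableGraph V)) : Prop :=
  ∃ φ ψ : Set V → ℝ, (∀ A, 0 < φ A) ∧ (∀ A, 0 < ψ A) ∧
    ∃ c : ℝ, 0 < c ∧
      ∀ (G : DecomposableGraph V) (T : SimpleGraph (MaxClique G.1)), IsJunctionTree G.1 T →
        P.real {G} = c * ((∏ C : MaxClique G.1, φ C.1) / ((separators T).map ψ).prod)

end GraphLaw

/-! Write f for the log density and U for log ψ. The proof turns both properties into statements
about f.

On `weakEvent A B` a graph is determined by its restrictions to A and B, and any two such
restrictions can be glued. The event is thus a product set, and independence on it means that all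
two-by-two minors of the density vanish: exchanging the B-parts of two graphs preserves the sum of
their f-values (`isWeaklyStructurallyMarkov_iff`).

In a junction tree the cliques containing a complete set X form a subtree, so they outnumber the
links whose separator contains X by exactly one. If U(S) is the sum of u over the subsets of S,
which Möbius inversion always allows, then ∑ U(C) over cliques minus ∑ U(S) over separators is the
sum of u over complete sets. Hence f factorises exactly when it is a constant plus a `cliqueSum`,
with U = log ψ and U + v = log φ (`IsJunctionTree.log_eq`). This form no longer mentions a tree.

A clique sum is additive over a weak split up to a term depending on A ∩ B alone, so it is
exchangeable (`isSwapInvariant_cliqueSum`). Conversely, for exchangeable f, choose v to match f on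
graphs with one complete block, and U to match f on one graph K_{S+a} ∪ K_{S+b} for each S. The
difference is exchangeable; it vanishes on all unions of two complete blocks
(`IsSwapInvariant.completeOn_sup_eq_zero`), hence on all decomposable graphs by perfect elimination
(`IsSwapInvariant.eq_zero`). -/

namespace GraphLaw

open Set

/-! ### Splits, decomposability and gluing -/

/-- `A ∩ B` is complete in `G` and no edge joins `A \ B` to `B \ A`. -/
structure IsSplit {V : Type*} (G : SimpleGraph V) (A B : Set V) : Prop where
  complete : G.IsClique (A ∩ B)
  not_adj : ∀ a ∈ A, a ∉ B → ∀ b ∈ B, b ∉ A → ¬G.Adj a b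

/-- `C` is a clique (a maximal complete set) of the induced subgraph `G_W`. -/
def IsMaxCliqueIn {V : Type*} (G : SimpleGraph V) (W C : Set V) : Prop :=
  Maximal (fun X => G.IsClique X ∧ X ⊆ W) C

/-- A split of `G` along a set which is a clique of the induced subgraph `G_A`. -/
structure IsWeakSplit {V : Type*} (G : SimpleGraph V) (A B : Set V) : Prop
    extends IsSplit G A B where
  maximal : IsMaxCliqueIn G A (A ∩ B)

/-- The graph with the edges of `G` inside `A`. -/
def res {V : Type*} (G : SimpleGraph V) (A : Set V) : SimpleGraph V where
  Adj x y := G.Adj x y ∧ x ∈ A ∧ y ∈ A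
  symm := ⟨fun _ _ h => ⟨h.1.symm, h.2.2, h.2.1⟩⟩
  loopless := ⟨fun _ h => h.1.ne rfl⟩

/-- The graph with the edges of `G` inside `A` and the edges of `H` inside `B`. -/
def glue {V : Type*} (A B : Set V) (G H : SimpleGraph V) : SimpleGraph V := res G A ⊔ res H B

/-- The graph in which `C` is complete and all other vertices are isolated. -/
def completeOn {V : Type*} (C : Set V) : SimpleGraph V := res ⊤ C

variable {V : Type*} {G H : SimpleGraph V} {A B C D S W X : Set V} {x y : V}

@[simp] lemma res_adj : (res G A).Adj x y ↔ G.Adj x y ∧ x ∈ A ∧ y ∈ A := Iff.rfl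

@[simp] lemma glue_adj : (glue A B G H).Adj x y ↔
    (G.Adj x y ∧ x ∈ A ∧ y ∈ A) ∨ (H.Adj x y ∧ x ∈ B ∧ y ∈ B) := Iff.rfl

@[simp] lemma completeOn_adj : (completeOn C).Adj x y ↔ x ≠ y ∧ x ∈ C ∧ y ∈ C := Iff.rfl

lemma isClique_congr (h : ∀ x ∈ X, ∀ y ∈ X, G.Adj x y ↔ H.Adj x y) :
    G.IsClique X ↔ H.IsClique X :=
  ⟨fun hc x hx y hy hn => (h x hx y hy).1 (hc hx hy hn),
    fun hc x hx y hy hn => (h x hx y hy).2 (hc hx hy hn)⟩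

lemma isMaxCliqueIn_congr (h : ∀ x ∈ W, ∀ y ∈ W, G.Adj x y ↔ H.Adj x y) :
    IsMaxCliqueIn G W X ↔ IsMaxCliqueIn H W X := by
  have : (fun X => G.IsClique X ∧ X ⊆ W) = (fun X => H.IsClique X ∧ X ⊆ W) := by
    funext X
    exact propext ⟨fun hX => ⟨(isClique_congr fun x hx y hy => h x (hX.2 hx) y (hX.2 hy)).1 hX.1,
      hX.2⟩, fun hX => ⟨(isClique_congr fun x hx y hy => h x (hX.2 hx) y (hX.2 hy)).2 hX.1, hX.2⟩⟩
  rw [IsMaxCliqueIn, IsMaxCliqueIn, this]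

lemma isMaxCliqueIn_univ : IsMaxCliqueIn G univ C ↔ Maximal G.IsClique C := by
  simp [IsMaxCliqueIn]

lemma isMaxCliqueIn_iff : IsMaxCliqueIn G W C ↔ G.IsClique C ∧ C ⊆ W ∧
    ∀ x ∈ W, (∀ y ∈ C, x ≠ y → G.Adj x y) → x ∈ C := by
  constructor
  · intro h
    refine ⟨h.prop.1, h.prop.2, fun x hx hxy => ?_⟩
    exact h.le_of_ge (y := insert x C) ⟨h.prop.1.insert hxy, insert_subset hx h.prop.2⟩
      (subset_insert x C) (mem_insert x C)
  · rintro ⟨h1, h2, h3⟩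
    refine ⟨⟨h1, h2⟩, fun Y hY hCY x hx => h3 x (hY.2 hx) fun y hy hn => hY.1 hx (hCY hy) hn⟩

lemma exists_isMaxCliqueIn [Finite V] (hX : G.IsClique X) (hW : X ⊆ W) :
    ∃ C, X ⊆ C ∧ IsMaxCliqueIn G W C :=
  (Set.toFinite {Y | G.IsClique Y ∧ Y ⊆ W}).exists_le_maximal (a := X) ⟨hX, hW⟩

lemma isSplit_of_isDecompositionOf (h : IsDecompositionOf G W A B) : IsSplit G A B := by
  refine ⟨h.complete, fun a ha ha' b hb hb' hab => ?_⟩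
  obtain ⟨v, hv, hv'⟩ := h.separates a ⟨ha, ha'⟩ b ⟨hb, hb'⟩ hab.toWalk (by
    intro v hv
    rw [← h.cover]
    simp at hv
    rcases hv with rfl | rfl
    exacts [Or.inl ha, Or.inr hb])
  simp at hv
  rcases hv with rfl | rfl
  exacts [ha' hv'.2, hb' hv'.1]

/-- A walk starting in A \ B can only step to a vertex of A, so it stays in A \ B until it meets A ∩
B. -/
lemma IsSplit.isDecompositionOf (h : IsSplit G A B) : IsDecompositionOf G (A ∪ B) A B := by
  refine ⟨rfl, h.complete, ?_⟩
  intro a ha b hb p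
  induction p with
  | nil => exact absurd hb.1 ha.2
  | @cons a c b hac p ih =>
    intro hp
    by_cases hc : c ∈ A ∩ B
    · exact ⟨c, by simp, hc⟩
    have hcA : c ∈ A := by
      rcases hp c (by simp) with hc' | hc'
      · exact hc'
      · by_contra hcA
        exact h.not_adj a ha.1 ha.2 c hc' hcA hac
    obtain ⟨v, hv, hv'⟩ := ih ⟨hcA, fun hcB => hc ⟨hcA, hcB⟩⟩ hb
      (fun v hv => hp v (by simp [hv]))
    exact ⟨v, by simp [hv], hv'⟩

lemma IsSplit.congr (h : IsSplit G A B)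
    (hGH : ∀ x ∈ A ∪ B, ∀ y ∈ A ∪ B, G.Adj x y ↔ H.Adj x y) : IsSplit H A B := by
  refine ⟨(isClique_congr fun x hx y hy => hGH x (Or.inl hx.1) y (Or.inl hy.1)).1 h.complete, ?_⟩
  intro a ha ha' b hb hb' hab
  exact h.not_adj a ha ha' b hb hb' ((hGH a (Or.inl ha) b (Or.inr hb)).2 hab)

lemma IsDecomposableOn.of_isSplit (h : IsSplit G A B) (hA : IsDecomposableOn G A)
    (hB : IsDecomposableOn G B) : IsDecomposableOn G (A ∪ B) := by
  by_cases h1 : A ⊆ B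
  · rwa [union_eq_right.2 h1]
  by_cases h2 : B ⊆ A
  · rwa [union_eq_left.2 h2]
  exact .decompose h.isDecompositionOf (sdiff_nonempty.2 h1) (sdiff_nonempty.2 h2) hA hB

/-- Induction on decomposability in terms of splits. -/
lemma IsDecomposableOn.split_induction {motive : Set V → Prop}
    (complete : ∀ W, G.IsClique W → motive W)
    (split : ∀ A B, IsSplit G A B → (A \ B).Nonempty → (B \ A).Nonempty → motive A → motive B →
      motive (A ∪ B)) (h : IsDecomposableOn G W) : motive W := by
  induction h with
  | complete h => exact complete _ h
  | decompose h hA hB _ _ ihA ihB =>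
    rw [← h.cover]
    exact split _ _ (isSplit_of_isDecompositionOf h) hA hB ihA ihB

lemma IsDecomposableOn.congr (h : IsDecomposableOn G W) :
    (∀ x ∈ W, ∀ y ∈ W, G.Adj x y ↔ H.Adj x y) → IsDecomposableOn H W := by
  refine split_induction (motive := fun W => (∀ x ∈ W, ∀ y ∈ W, G.Adj x y ↔ H.Adj x y) →
    IsDecomposableOn H W) ?_ ?_ h
  · exact fun W hW hGH => .complete ((isClique_congr hGH).1 hW)
  · intro A B hs _ _ ihA ihB hGH
    exact .of_isSplit (hs.congr hGH)
      (ihA fun x hx y hy => hGH x (Or.inl hx) y (Or.inl hy))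
      (ihB fun x hx y hy => hGH x (Or.inr hx) y (Or.inr hy))

lemma IsDecomposableOn.subset (h : IsDecomposableOn G W) :
    ∀ {W'}, W' ⊆ W → IsDecomposableOn G W' := by
  refine split_induction (motive := fun W => ∀ {W'}, W' ⊆ W → IsDecomposableOn G W') ?_ ?_ h
  · exact fun W hW _ hW' => .complete (hW.subset hW')
  · intro A B hs _ _ ihA ihB W' hW'
    have : W' = (A ∩ W') ∪ (B ∩ W') := by
      rw [← union_inter_distrib_right, inter_eq_right.2 hW']
    rw [this]
    refine .of_isSplit ⟨
        SimpleGraph.IsClique.subset (s := A ∩ B) (fun x hx => ⟨hx.1.1, hx.2.1⟩) hs.complete, ?_⟩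
      (ihA inter_subset_left) (ihB inter_subset_left)
    intro a ha ha' b hb hb' hab
    exact hs.not_adj a ha.1 (fun h => ha' ⟨h, ha.2⟩) b hb.1 (fun h => hb' ⟨h, hb.2⟩) hab

/-- The vertices outside A are isolated and can be added one at a time, each by a split with empty
intersection. -/
lemma isDecomposable_res [Finite V] (h : IsDecomposableOn G A) : IsDecomposable (res G A) := by
  have key : ∀ F : Set V, F.Finite → Disjoint A F → IsDecomposableOn (res G A) (A ∪ F) := by
    intro F hF
    induction F, hF using Set.Finite.induction_on with
    | empty =>
      intro _
      rw [union_empty]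
      exact h.congr fun x hx y hy => by simp [hx, hy]
    | @insert x F hx _ ih =>
      intro hd
      rw [disjoint_insert_right] at hd
      rw [← union_singleton, ← union_assoc]
      refine .of_isSplit ⟨?_, ?_⟩ (ih hd.2) (.complete (by simp))
      · exact SimpleGraph.IsClique.of_subsingleton
          (subsingleton_singleton.anti inter_subset_right)
      · rintro a _ _ b rfl _ hab
        exact hd.1 hab.2.2
  have := key Aᶜ (toFinite _) disjoint_compl_right
  rwa [union_compl_self] at this

lemma isDecomposable_completeOn [Finite V] : IsDecomposable (completeOn C) :=
  isDecomposable_res (.complete fun _ _ _ _ h => h)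

lemma IsSplit.glue (hG : G.IsClique (A ∩ B)) :
    IsSplit (glue A B G H) A B := by
  refine ⟨fun x hx y hy hn => Or.inl ⟨hG hx hy hn, hx.1, hy.1⟩, ?_⟩
  rintro a ha ha' b hb hb' (⟨_, _, h⟩ | ⟨_, h, _⟩)
  exacts [hb' h, ha' h]

lemma glue_adj_left (hG : G.IsClique (A ∩ B)) (hx : x ∈ A) (hy : y ∈ A) :
    (glue A B G H).Adj x y ↔ G.Adj x y := by
  rw [glue_adj]
  refine ⟨?_, fun h => Or.inl ⟨h, hx, hy⟩⟩
  rintro (h | h)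
  exacts [h.1, hG ⟨hx, h.2.1⟩ ⟨hy, h.2.2⟩ h.1.ne]

lemma glue_adj_right (hH : H.IsClique (A ∩ B)) (hx : x ∈ B) (hy : y ∈ B) :
    (glue A B G H).Adj x y ↔ H.Adj x y := by
  rw [glue_adj]
  refine ⟨?_, fun h => Or.inr ⟨h, hx, hy⟩⟩
  rintro (h | h)
  exacts [hH ⟨h.2.1, hx⟩ ⟨h.2.2, hy⟩ h.1.ne, h.1]

lemma isDecomposable_glue (hc : A ∪ B = univ) (hG : G.IsClique (A ∩ B)) (hH : H.IsClique (A ∩ B))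
    (dG : IsDecomposable G) (dH : IsDecomposable H) : IsDecomposable (glue A B G H) := by
  rw [IsDecomposable, ← hc]
  refine .of_isSplit (IsSplit.glue hG) ?_ ?_
  · exact (dG.subset (subset_univ A)).congr fun x hx y hy => (glue_adj_left hG hx hy).symm
  · exact (dH.subset (subset_univ B)).congr fun x hx y hy => (glue_adj_right hH hx hy).symm

lemma IsWeakSplit.glue (hG : IsWeakSplit G A B) :
    IsWeakSplit (glue A B G H) A B :=
  ⟨IsSplit.glue hG.complete,
    (isMaxCliqueIn_congr fun _ hx _ hy => glue_adj_left hG.complete hx hy).2 hG.maximal⟩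

lemma IsSplit.adj_cases (h : IsSplit G A B) (hx : x ∈ A ∪ B) (hy : y ∈ A ∪ B) (hxy : G.Adj x y) :
    (x ∈ A ∧ y ∈ A) ∨ (x ∈ B ∧ y ∈ B) := by
  have h1 := h.not_adj x
  have h2 := h.not_adj y
  have h3 := hxy.symm
  simp only [mem_union] at hx hy
  tauto

lemma IsSplit.eq_of_forall_adj (hc : A ∪ B = univ) (hG : IsSplit G A B) (hH : IsSplit H A B)
    (hA : ∀ x ∈ A, ∀ y ∈ A, G.Adj x y ↔ H.Adj x y)
    (hB : ∀ x ∈ B, ∀ y ∈ B, G.Adj x y ↔ H.Adj x y) : G = H := by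
  ext x y
  have hx : x ∈ A ∪ B := hc ▸ mem_univ x
  have hy : y ∈ A ∪ B := hc ▸ mem_univ y
  constructor
  · intro h
    rcases hG.adj_cases hx hy h with h' | h'
    exacts [(hA x h'.1 y h'.2).1 h, (hB x h'.1 y h'.2).1 h]
  · intro h
    rcases hH.adj_cases hx hy h with h' | h'
    exacts [(hA x h'.1 y h'.2).2 h, (hB x h'.1 y h'.2).2 h]

/-! ### Simplicial vertices and perfect elimination -/

/-- The neighbours of `r` inside `W` form a complete set. -/
def IsSimplicialIn (G : SimpleGraph V) (W : Set V) (r : V) : Prop :=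
  G.IsClique {x ∈ W | G.Adj r x}

lemma IsSplit.isSimplicialIn_union (h : IsSplit G A B) (hx : x ∈ A) (hxB : x ∉ B)
    (hs : IsSimplicialIn G A x) : IsSimplicialIn G (A ∪ B) x := by
  refine SimpleGraph.IsClique.subset (t := {y ∈ A ∪ B | G.Adj x y}) ?_ hs
  rintro y ⟨hy, hxy⟩
  rcases h.adj_cases (Or.inl hx) hy hxy with h' | h'
  exacts [⟨h'.2, hxy⟩, absurd h'.1 hxB]

lemma IsSplit.symm (h : IsSplit G A B) : IsSplit G B A :=
  ⟨inter_comm A B ▸ h.complete, fun a ha ha' b hb hb' hab => h.not_adj b hb hb' a ha ha' hab.symm⟩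

/-- Dirac's argument. Asking for two non-adjacent vertices makes the induction work: A ∩ B is
complete, so it cannot contain both, and one that lies outside B keeps its neighbourhood in A ∪ B.
-/
lemma IsDecomposableOn.isClique_or_exists_pair (h : IsDecomposableOn G W) :
    G.IsClique W ∨ ∃ a ∈ W, ∃ b ∈ W, a ≠ b ∧ ¬G.Adj a b ∧
      IsSimplicialIn G W a ∧ IsSimplicialIn G W b := by
  refine split_induction (motive := fun W => G.IsClique W ∨ ∃ a ∈ W, ∃ b ∈ W, a ≠ b ∧
    ¬G.Adj a b ∧ IsSimplicialIn G W a ∧ IsSimplicialIn G W b) ?_ ?_ h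
  · exact fun W hW => Or.inl hW
  · intro A B hs hA hB ihA ihB
    have key : ∀ {A B : Set V}, IsSplit G A B → (A \ B).Nonempty →
        (G.IsClique A ∨ ∃ a ∈ A, ∃ b ∈ A, a ≠ b ∧ ¬G.Adj a b ∧
          IsSimplicialIn G A a ∧ IsSimplicialIn G A b) →
        ∃ a ∈ A, a ∉ B ∧ IsSimplicialIn G (A ∪ B) a := by
      rintro A B hs ⟨a, ha, ha'⟩ (hA | ⟨a, ha, b, hb, hn, hab, sa, sb⟩)
      · exact ⟨a, ha, ha', hs.isSimplicialIn_union ha ha' (hA.subset (sep_subset _ _))⟩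
      · by_cases haB : a ∈ B
        · have hbB : b ∉ B := fun hbB => hab (hs.complete ⟨ha, haB⟩ ⟨hb, hbB⟩ hn)
          exact ⟨b, hb, hbB, hs.isSimplicialIn_union hb hbB sb⟩
        · exact ⟨a, ha, haB, hs.isSimplicialIn_union ha haB sa⟩
    obtain ⟨a, ha, ha', sa⟩ := key hs hA ihA
    obtain ⟨b, hb, hb', sb⟩ := key hs.symm hB ihB
    rw [union_comm] at sb
    exact Or.inr ⟨a, Or.inl ha, b, Or.inr hb, fun h => ha' (h ▸ hb), hs.not_adj a ha ha' b hb hb',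
      sa, sb⟩

/-- A nonempty decomposable graph has a simplicial vertex. -/
lemma IsDecomposableOn.exists_isSimplicialIn (h : IsDecomposableOn G W) (hW : W.Nonempty) :
    ∃ r ∈ W, IsSimplicialIn G W r := by
  rcases h.isClique_or_exists_pair with h | ⟨a, ha, _, _, _, _, sa, _⟩
  · obtain ⟨r, hr⟩ := hW
    exact ⟨r, hr, h.subset (sep_subset _ _)⟩
  · exact ⟨a, ha, sa⟩

/-- Perfect elimination: a property of vertex sets passes up along simplicial vertices. -/
lemma IsDecomposableOn.elimination_induction [Finite V] {motive : Set V → Prop}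
    (h : IsDecomposableOn G W) (empty : motive ∅)
    (step : ∀ W r, r ∉ W → G.IsClique {x ∈ W | G.Adj r x} → motive W → motive (insert r W)) :
    motive W := by
  induction hn : W.ncard generalizing W with
  | zero => rwa [(ncard_eq_zero (toFinite W)).1 hn]
  | succ n ih =>
    obtain ⟨r, hr, sr⟩ := h.exists_isSimplicialIn (nonempty_of_ncard_ne_zero (by omega))
    rw [← insert_sdiff_self_of_mem hr]
    refine step _ r (by simp) 
      (SimpleGraph.IsClique.subset (s := {x ∈ W | G.Adj r x}) (fun x hx => ⟨hx.1.1, hx.2⟩) sr)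
      (ih (h.subset sdiff_subset) ?_)
    rw [ncard_sdiff_singleton_of_mem hr, hn, Nat.add_sub_cancel]

end GraphLaw

/-! ### Clique sums and their behaviour under splits -/

namespace GraphLaw

open Set

open Classical in
/-- The sum of `u` over the complete sets of `G_W` and of `v` over the cliques of `G_W`. -/
noncomputable def cliqueSum {V : Type*} [Fintype (Set V)] (u v : Set V → ℝ) (G : SimpleGraph V)
    (W : Set V) : ℝ :=
  ∑ X : Set V, ((if G.IsClique X ∧ X ⊆ W then u X else 0) + if IsMaxCliqueIn G W X then v X else 0)

open Classical in
/-- The sum of `u` over all subsets of `S`. -/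
noncomputable def subsetSum {V : Type*} [Fintype (Set V)] (u : Set V → ℝ) (S : Set V) : ℝ :=
  ∑ X : Set V, if X ⊆ S then u X else 0

variable {V : Type*} {G H : SimpleGraph V} {A B C D S W X : Set V} {x y : V}

lemma IsMaxCliqueIn.mono (h : IsMaxCliqueIn G W X) (hA : A ⊆ W) (hX : X ⊆ A) :
    IsMaxCliqueIn G A X :=
  ⟨⟨h.prop.1, hX⟩, fun _ hY hXY => h.le_of_ge ⟨hY.1, hY.2.trans hA⟩ hXY⟩

lemma IsSplit.subset_or_subset (h : IsSplit G A B) (hX : G.IsClique X) (hs : X ⊆ A ∪ B) :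
    X ⊆ A ∨ X ⊆ B := by
  by_contra! hcon
  obtain ⟨⟨x, hx, hxA⟩, ⟨y, hy, hyB⟩⟩ := not_subset.1 hcon.1, not_subset.1 hcon.2
  have hxB : x ∈ B := (hs hx).resolve_left hxA
  have hyA : y ∈ A := (hs hy).resolve_right hyB
  exact h.not_adj y hyA hyB x hxB hxA (hX hy hx fun e => hyB (e ▸ hxB))

lemma IsSplit.isMaxCliqueIn_union_of_left (h : IsSplit G A B) (hX : IsMaxCliqueIn G A X)
    (hn : X ≠ A ∩ B) : IsMaxCliqueIn G (A ∪ B) X := by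
  refine ⟨⟨hX.prop.1, hX.prop.2.trans subset_union_left⟩, fun Y hY hXY => ?_⟩
  rcases h.subset_or_subset hY.1 hY.2 with hYA | hYB
  · exact hX.le_of_ge ⟨hY.1, hYA⟩ hXY
  · have hXS : X ⊆ A ∩ B := subset_inter hX.prop.2 (Subset.trans hXY hYB)
    exact absurd (hXS.antisymm (hX.le_of_ge ⟨h.complete, inter_subset_left⟩ hXS)) hn

lemma IsSplit.isMaxCliqueIn_union_iff_of_ne (h : IsSplit G A B) (hn : X ≠ A ∩ B) :
    IsMaxCliqueIn G (A ∪ B) X ↔ IsMaxCliqueIn G A X ∨ IsMaxCliqueIn G B X := by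
  constructor
  · intro hX
    exact (h.subset_or_subset hX.prop.1 hX.prop.2).imp (hX.mono subset_union_left)
      (hX.mono subset_union_right)
  · rintro (hX | hX)
    · exact h.isMaxCliqueIn_union_of_left hX hn
    · rw [union_comm]
      exact h.symm.isMaxCliqueIn_union_of_left hX (inter_comm A B ▸ hn)

lemma IsSplit.isMaxCliqueIn_union_inter_iff (h : IsSplit G A B) :
    IsMaxCliqueIn G (A ∪ B) (A ∩ B) ↔ IsMaxCliqueIn G A (A ∩ B) ∧ IsMaxCliqueIn G B (A ∩ B) := by
  refine ⟨fun hX => ⟨hX.mono subset_union_left inter_subset_left,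
    hX.mono subset_union_right inter_subset_right⟩, fun hX => ?_⟩
  refine ⟨⟨h.complete, inter_subset_left.trans subset_union_left⟩, fun Y hY hXY => ?_⟩
  rcases h.subset_or_subset hY.1 hY.2 with hYA | hYB
  exacts [hX.1.le_of_ge ⟨hY.1, hYA⟩ hXY, hX.2.le_of_ge ⟨hY.1, hYB⟩ hXY]

lemma IsSplit.eq_inter_of_isMaxCliqueIn (h : IsSplit G A B) (hA : IsMaxCliqueIn G A X)
    (hB : IsMaxCliqueIn G B X) : X = A ∩ B := by
  have hXS := subset_inter hA.prop.2 hB.prop.2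
  exact hXS.antisymm (hA.le_of_ge ⟨h.complete, inter_subset_left⟩ hXS)

lemma isMaxCliqueIn_iff_eq_of_isClique (h : G.IsClique W) : IsMaxCliqueIn G W X ↔ X = W := by
  refine ⟨fun hX => Subset.antisymm hX.prop.2 (hX.le_of_ge ⟨h, le_rfl⟩ hX.prop.2), ?_⟩
  rintro rfl
  exact ⟨⟨h, le_rfl⟩, fun _ hY _ => hY.2⟩

variable [Fintype (Set V)] {u v : Set V → ℝ}

-- Only X = A ∩ B can be maximal on a side without being maximal in the union, or be maximal on both
-- sides. If it is maximal on both, the right side counts it twice and the union once; if on exactly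
-- one, the counts are one and zero. The excess is a single v (A ∩ B) in either case.
open Classical in
lemma IsSplit.cliqueSum_union (h : IsSplit G A B) :
    cliqueSum u v G (A ∪ B) + (subsetSum u (A ∩ B) +
      if IsMaxCliqueIn G A (A ∩ B) ∨ IsMaxCliqueIn G B (A ∩ B) then v (A ∩ B) else 0) =
    cliqueSum u v G A + cliqueSum u v G B := by
  have hv : (if IsMaxCliqueIn G A (A ∩ B) ∨ IsMaxCliqueIn G B (A ∩ B) then v (A ∩ B) else 0) =
      ∑ X, if X = A ∩ B then
        (if IsMaxCliqueIn G A X ∨ IsMaxCliqueIn G B X then v X else 0) else 0 := by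
    rw [Finset.sum_ite_eq' Finset.univ (A ∩ B)
      (fun X => if IsMaxCliqueIn G A X ∨ IsMaxCliqueIn G B X then v X else 0)]
    simp
  rw [hv]
  simp only [cliqueSum, subsetSum, ← Finset.sum_add_distrib]
  refine Finset.sum_congr rfl fun X _ => ?_
  have hu : (if G.IsClique X ∧ X ⊆ A ∪ B then u X else 0) + (if X ⊆ A ∩ B then u X else 0) =
      (if G.IsClique X ∧ X ⊆ A then u X else 0) + (if G.IsClique X ∧ X ⊆ B then u X else 0) := by
    have h1 : X ⊆ A ∩ B → G.IsClique X := fun hX => h.complete.subset hX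
    have h2 := h.subset_or_subset (X := X)
    have h3 : X ⊆ A → X ⊆ A ∪ B := fun hX => hX.trans subset_union_left
    have h4 : X ⊆ B → X ⊆ A ∪ B := fun hX => hX.trans subset_union_right
    rw [subset_inter_iff] at *
    by_cases hc : G.IsClique X <;> by_cases hA : X ⊆ A <;> by_cases hB : X ⊆ B <;>
      simp_all
  have hm : (if IsMaxCliqueIn G (A ∪ B) X then v X else 0) + (if X = A ∩ B then
        (if IsMaxCliqueIn G A X ∨ IsMaxCliqueIn G B X then v X else 0) else 0) =
      (if IsMaxCliqueIn G A X then v X else 0) + (if IsMaxCliqueIn G B X then v X else 0) := by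
    by_cases hX : X = A ∩ B
    · subst hX
      rw [h.isMaxCliqueIn_union_inter_iff]
      by_cases hA : IsMaxCliqueIn G A (A ∩ B) <;> by_cases hB : IsMaxCliqueIn G B (A ∩ B) <;>
        simp [hA, hB]
    · rw [h.isMaxCliqueIn_union_iff_of_ne hX]
      have := h.eq_inter_of_isMaxCliqueIn (X := X)
      by_cases hA : IsMaxCliqueIn G A X <;> by_cases hB : IsMaxCliqueIn G B X <;>
        simp_all
  linarith

lemma cliqueSum_congr (h : ∀ x ∈ W, ∀ y ∈ W, G.Adj x y ↔ H.Adj x y) :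
    cliqueSum u v G W = cliqueSum u v H W := by
  classical
  refine Finset.sum_congr rfl fun X _ => ?_
  have : G.IsClique X ∧ X ⊆ W ↔ H.IsClique X ∧ X ⊆ W :=
    and_congr_left fun hX => isClique_congr fun x hx y hy => h x (hX hx) y (hX hy)
  exact congrArg₂ _ (if_congr this rfl rfl) (if_congr (isMaxCliqueIn_congr h) rfl rfl)

/-- Maximality on the A side settles the disjunction, so the correction no longer depends on the
graph. -/
lemma IsWeakSplit.cliqueSum_union (h : IsWeakSplit G A B) :
    cliqueSum u v G (A ∪ B) + (subsetSum u (A ∩ B) + v (A ∩ B)) =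
    cliqueSum u v G A + cliqueSum u v G B := by
  rw [← h.toIsSplit.cliqueSum_union, if_pos (Or.inl h.maximal)]

lemma cliqueSum_of_isClique (h : G.IsClique W) : cliqueSum u v G W = subsetSum u W + v W := by
  classical
  have hc : ∀ X, G.IsClique X ∧ X ⊆ W ↔ X ⊆ W := fun X => and_iff_right_of_imp h.subset
  simp [cliqueSum, subsetSum, Finset.sum_add_distrib, isMaxCliqueIn_iff_eq_of_isClique h, hc]

/-- An isolated vertex adds the clique {x} and an empty separator, both of weight zero. Nonemptiness
of W matters: ∅ is a clique of the graph on no vertices. -/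
lemma cliqueSum_insert_of_isolated (h0 : subsetSum u ∅ = 0) (hx : x ∉ W)
    (h1 : subsetSum u {x} + v {x} = 0) (hW : W.Nonempty) (hG : ∀ y, ¬G.Adj x y) :
    cliqueSum u v G (insert x W) = cliqueSum u v G W := by
  have hi : W ∩ {x} = ∅ := by simpa using hx
  have hs : IsSplit G W {x} := by
    refine ⟨by simp [hi], ?_⟩
    rintro a _ _ b rfl _ hab
    exact hG a hab.symm
  have := hs.cliqueSum_union (u := u) (v := v)
  rw [hi, h0, if_neg, cliqueSum_of_isClique (W := {x}) (by simp), h1, union_singleton] at this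
  · linarith
  · rw [isMaxCliqueIn_iff, isMaxCliqueIn_iff]
    obtain ⟨y, hy⟩ := hW
    rintro (h | h)
    · simpa using h.2.2 y hy
    · simpa using h.2.2 x rfl

lemma cliqueSum_union_of_isolated [Finite V] (h0 : subsetSum u ∅ = 0)
    (h1 : ∀ x, subsetSum u {x} + v {x} = 0) (hW : W.Nonempty) (hG : ∀ x ∉ W, ∀ y, ¬G.Adj x y) :
    cliqueSum u v G univ = cliqueSum u v G W := by
  have key : ∀ F : Set V, F.Finite → Disjoint W F →
      cliqueSum u v G (F ∪ W) = cliqueSum u v G W := by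
    intro F hF
    induction F, hF using Set.Finite.induction_on with
    | empty => simp
    | @insert x F hx _ ih =>
      intro hd
      rw [disjoint_insert_right] at hd
      rw [insert_union, cliqueSum_insert_of_isolated h0 _ (h1 x) (hW.mono subset_union_right)
        (hG x hd.1), ih hd.2]
      simp [hx, hd.1]
  have := key Wᶜ (toFinite _) disjoint_compl_right
  rwa [compl_union_self] at this

/-- Möbius inversion over subsets, as existence of a solution. -/
lemma exists_subsetSum_eq (U : Set V → ℝ) : ∃ u : Set V → ℝ, ∀ S, subsetSum u S = U S := by
  classical
  have : Finite (Set V) := inferInstance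
  have wf : WellFounded ((· < ·) : Set V → Set V → Prop) := wellFounded_lt
  let F : (S : Set V) → ((X : Set V) → X < S → ℝ) → ℝ :=
    fun S ih => U S - ∑ X : Set V, if h : X < S then ih X h else 0
  refine ⟨wf.fix F, fun S => ?_⟩
  have h1 : wf.fix F S = U S - ∑ X : Set V, if X < S then wf.fix F X else 0 := by
    conv_lhs => rw [wf.fix_eq]
    simp [F]
  have h2 : subsetSum (wf.fix F) S = ∑ X : Set V, ((if X < S then wf.fix F X else 0) +
      if X = S then wf.fix F X else 0) := by
    refine Finset.sum_congr rfl fun X _ => ?_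
    by_cases hX : X = S
    · subst hX; simp
    · simp [hX, ssubset_iff_subset_ne]
  rw [h2, Finset.sum_add_distrib, Finset.sum_ite_eq' Finset.univ S (wf.fix F)]
  simp [h1]

/-! ### The exchange property -/

/-- The exchange property that weak structural Markovianity imposes on the log density. -/
def IsSwapInvariant {V : Type*} (f : SimpleGraph V → ℝ) : Prop :=
  ∀ A B : Set V, A ∪ B = univ → ∀ G H : SimpleGraph V, IsDecomposable G → IsDecomposable H →
    IsWeakSplit G A B → IsWeakSplit H A B →
      f G + f H = f (glue A B G H) + f (glue A B H G)

lemma isSwapInvariant_cliqueSum : IsSwapInvariant fun G => cliqueSum u v G univ := by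
  intro A B hc G H _ _ hG hH
  have e1 := hG.cliqueSum_union (u := u) (v := v)
  have e2 := hH.cliqueSum_union (u := u) (v := v)
  have e3 := (hG.glue (H := H)).cliqueSum_union (u := u) (v := v)
  have e4 := (hH.glue (H := G)).cliqueSum_union (u := u) (v := v)
  rw [cliqueSum_congr (W := A) fun x hx y hy => glue_adj_left hG.complete hx hy,
    cliqueSum_congr (W := B) fun x hx y hy => glue_adj_right hH.complete hx hy] at e3
  rw [cliqueSum_congr (W := A) fun x hx y hy => glue_adj_left hH.complete hx hy,
    cliqueSum_congr (W := B) fun x hx y hy => glue_adj_right hG.complete hx hy] at e4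
  rw [hc] at e1 e2 e3 e4
  dsimp only
  linarith

end GraphLaw

/-! ### Exchangeable functions are clique sums -/

namespace GraphLaw

open Set

variable {V : Type*} {G H : SimpleGraph V} {A B C D E S W X : Set V} {a b c d x y : V}
  {f δ : SimpleGraph V → ℝ}

lemma IsWeakSplit.completeOn (h : IsWeakSplit G A B) : IsWeakSplit (completeOn (A ∩ B)) A B := by
  refine ⟨⟨fun x hx y hy hn => ⟨hn, hx, hy⟩, ?_⟩, ?_⟩
  · intro a _ ha' b _ _ hab
    exact ha' hab.2.1.2
  · rw [isMaxCliqueIn_iff]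
    refine ⟨fun x hx y hy hn => ⟨hn, hx, hy⟩, inter_subset_left, fun x hx hxy => ?_⟩
    by_contra hxS
    exact hxS ((isMaxCliqueIn_iff.1 h.maximal).2.2 x hx fun y hy hn =>
      absurd (hxy y hy hn).2.1 hxS)

/-- Exchange with the graph that is complete on A ∩ B and has no other edges: gluing either part of
G to it leaves just that part. -/
lemma IsSwapInvariant.add_completeOn [Finite V] (hf : IsSwapInvariant f) (hc : A ∪ B = univ)
    (dG : IsDecomposable G) (hG : IsWeakSplit G A B) :
    f G + f (completeOn (A ∩ B)) = f (res G A) + f (res G B) := by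
  rw [hf A B hc G _ dG isDecomposable_completeOn hG hG.completeOn]
  congr 2
  · ext x y
    simp only [glue_adj, completeOn_adj, res_adj]
    refine ⟨?_, Or.inl⟩
    rintro (h | ⟨⟨hn, h1, h2⟩, _⟩)
    exacts [h, ⟨hG.complete h1 h2 hn, h1.1, h2.1⟩]
  · ext x y
    simp only [glue_adj, completeOn_adj, res_adj]
    refine ⟨?_, Or.inr⟩
    rintro (⟨⟨hn, h1, h2⟩, _⟩ | h)
    exacts [⟨hG.complete h1 h2 hn, h1.2, h2.2⟩, h]

lemma isSplit_completeOn_sup : IsSplit (completeOn C ⊔ completeOn D) C D := by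
  refine ⟨fun x hx y hy hn => Or.inl ⟨hn, hx.1, hy.1⟩, ?_⟩
  rintro a ha ha' b hb hb' (h | h)
  exacts [hb' h.2.2, ha' h.2.1]

lemma isDecomposable_completeOn_sup [Finite V] :
    IsDecomposable (completeOn C ⊔ completeOn D) := by
  have h : IsDecomposableOn (completeOn C ⊔ completeOn D) (C ∪ D) :=
    .of_isSplit isSplit_completeOn_sup (.complete fun x hx y hy hn => Or.inl ⟨hn, hx, hy⟩)
      (.complete fun x hx y hy hn => Or.inr ⟨hn, hx, hy⟩)
  have e : res (completeOn C ⊔ completeOn D) (C ∪ D) = completeOn C ⊔ completeOn D := by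
    ext x y
    simp only [res_adj, SimpleGraph.sup_adj, completeOn_adj, mem_union]
    tauto
  exact e ▸ isDecomposable_res h

/-- Split along E by the cover (C ∪ E, D ∪ Cᶜ); the parts are K_C ∪ K_E and K_D. A vertex of E \ C
has all its neighbours in D, so a vertex of C ∪ E that extends E lies in D and hence in E: this is
the maximality a weak split requires. -/
lemma IsSwapInvariant.completeOn_sup_eq [Finite V] (hδ : IsSwapInvariant δ)
    (h0 : ∀ C, δ (completeOn C) = 0) (hED : E ⊆ D) (hCE : C ∩ D ⊆ E) (hE : (E \ C).Nonempty) :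
    δ (completeOn C ⊔ completeOn D) = δ (completeOn C ⊔ completeOn E) := by
  have hc : (C ∪ E) ∪ (D ∪ Cᶜ) = univ := by
    ext x
    simp only [mem_union, mem_compl_iff, mem_univ, iff_true]
    tauto
  have hi : (C ∪ E) ∩ (D ∪ Cᶜ) = E := by
    ext x
    have h1 := @hED x
    have h2 := @hCE x
    simp only [mem_inter_iff, mem_union, mem_compl_iff] at *
    tauto
  have hw : IsWeakSplit (completeOn C ⊔ completeOn D) (C ∪ E) (D ∪ Cᶜ) := by
    refine ⟨⟨?_, ?_⟩, ?_⟩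
    · rw [hi]
      exact fun x hx y hy hn => Or.inr ⟨hn, hED hx, hED hy⟩
    · intro a _ ha' b _ hb'
      simp only [mem_union, mem_compl_iff, not_or, SimpleGraph.sup_adj, completeOn_adj] at *
      tauto
    · rw [hi, isMaxCliqueIn_iff]
      refine ⟨fun x hx y hy hn => Or.inr ⟨hn, hED hx, hED hy⟩, subset_union_right,
        fun x hx hxy => ?_⟩
      obtain ⟨y, hy, hyC⟩ := hE
      by_cases hn : x = y
      · rwa [hn]
      · have h2 := @hCE x
        have h3 := hxy y hy hn
        simp only [mem_inter_iff, mem_union, SimpleGraph.sup_adj, completeOn_adj] at *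
        tauto
  have key := hδ.add_completeOn hc isDecomposable_completeOn_sup hw
  have e1 : res (completeOn C ⊔ completeOn D) (C ∪ E) = completeOn C ⊔ completeOn E := by
    ext x y
    have h1 := @hED x
    have h2 := @hCE x
    have h3 := @hED y
    have h4 := @hCE y
    simp only [res_adj, SimpleGraph.sup_adj, completeOn_adj, mem_union, mem_inter_iff] at *
    tauto
  have e2 : res (completeOn C ⊔ completeOn D) (D ∪ Cᶜ) = completeOn D := by
    ext x y
    simp only [res_adj, SimpleGraph.sup_adj, completeOn_adj, mem_union, mem_compl_iff] at *
    tauto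
  rwa [e1, e2, h0, h0, add_zero, add_zero] at key

/-- Both sides are shrinkings of the same graph, whose second block is S + b + d. -/
lemma IsSwapInvariant.completeOn_insert_sup_eq [Finite V] (hδ : IsSwapInvariant δ)
    (h0 : ∀ C, δ (completeOn C) = 0) (hc : c ∉ S) (hb : b ∉ S) (hd : d ∉ S)
    (hcb : c ≠ b) (hcd : c ≠ d) :
    δ (completeOn (insert c S) ⊔ completeOn (insert d S)) =
      δ (completeOn (insert c S) ⊔ completeOn (insert b S)) := by
  have hD : insert c S ∩ insert d (insert b S) ⊆ S := by
    rintro x ⟨rfl | hx, hx'⟩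
    · simpa [hcb, hcd] using hx'
    · exact hx
  rw [← hδ.completeOn_sup_eq h0 (C := insert c S) (D := insert d (insert b S)) (E := insert d S),
    ← hδ.completeOn_sup_eq h0 (C := insert c S) (D := insert d (insert b S)) (E := insert b S)]
  · exact subset_insert _ _
  · exact hD.trans (subset_insert _ _)
  · exact ⟨b, by simp, by simp [hcb.symm, hb]⟩
  · exact insert_subset_insert (subset_insert _ _)
  · exact hD.trans (subset_insert _ _)
  · exact ⟨d, by simp, by simp [hcd.symm, hd]⟩

/-- Shrink both blocks to S + c and S + d, where S = C ∩ D, then move the two extra vertices to the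
pair a, b at which the value is known. -/
lemma IsSwapInvariant.completeOn_sup_eq_zero [Finite V] (hδ : IsSwapInvariant δ)
    (h0 : ∀ C, δ (completeOn C) = 0)
    (h1 : ∀ S : Set V, (∃ a b, a ∉ S ∧ b ∉ S ∧ a ≠ b) → ∃ a b, a ∉ S ∧ b ∉ S ∧ a ≠ b ∧
      δ (completeOn (insert a S) ⊔ completeOn (insert b S)) = 0) (C D : Set V) :
    δ (completeOn C ⊔ completeOn D) = 0 := by
  have mono : ∀ {C D : Set V}, C ⊆ D → completeOn C ≤ completeOn D :=
    fun h x y hxy => ⟨hxy.1, h hxy.2.1, h hxy.2.2⟩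
  by_cases hCD : C ⊆ D
  · rw [sup_eq_right.2 (mono hCD), h0]
  by_cases hDC : D ⊆ C
  · rw [sup_eq_left.2 (mono hDC), h0]
  obtain ⟨c, hc, hcD⟩ := not_subset.1 hCD
  obtain ⟨d, hd, hdC⟩ := not_subset.1 hDC
  have hcS : c ∉ C ∩ D := fun h => hcD h.2
  have hdS : d ∉ C ∩ D := fun h => hdC h.1
  have hcd : c ≠ d := fun h => hcD (h ▸ hd)
  rw [hδ.completeOn_sup_eq h0 (E := insert d (C ∩ D)) (insert_subset hd inter_subset_right)
    (subset_insert _ _) ⟨d, by simp, hdC⟩, sup_comm,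
    hδ.completeOn_sup_eq h0 (E := insert c (C ∩ D)) (insert_subset hc inter_subset_left) ?_
      ⟨c, by simp, by simp [hcd, hcD]⟩]
  · obtain ⟨a, b, ha, hb, hab, h⟩ := h1 (C ∩ D) ⟨c, d, hcS, hdS, hcd⟩
    -- With c fixed, d moves to b; with b fixed, c then moves to a. The first move needs c ≠ b;
    -- otherwise d moves directly to a.
    by_cases hcb : c = b
    · subst hcb
      rw [hδ.completeOn_insert_sup_eq h0 hdS hb hcS hcd.symm hcd.symm, sup_comm,
        hδ.completeOn_insert_sup_eq h0 hcS ha hdS hab.symm hcd, sup_comm, h]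
    · rw [sup_comm, hδ.completeOn_insert_sup_eq h0 hcS hb hdS hcb hcd, sup_comm,
        hδ.completeOn_insert_sup_eq h0 hb ha hcS hab.symm (Ne.symm hcb), sup_comm, h]
  · rintro x ⟨rfl | hx, hx'⟩
    exacts [absurd hx' hdC, Or.inr hx]

/-- Induction along a perfect elimination order: a weak split separates the new simplicial vertex r
from the earlier graph, leaving a part with at most two complete blocks. -/
lemma IsSwapInvariant.eq_zero [Finite V] (hδ : IsSwapInvariant δ)
    (h0 : ∀ C, δ (completeOn C) = 0)
    (h2 : ∀ C D, δ (completeOn C ⊔ completeOn D) = 0) (hG : IsDecomposable G) : δ G = 0 := by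
  have key : δ (res G univ) = 0 := by
    refine IsDecomposableOn.elimination_induction (motive := fun W => δ (res G W) = 0) hG ?_ ?_
    · convert h0 ∅ using 2
      ext x y
      simp
    · intro W r hr hN ih
      set K := res G (insert r W) with hK
      have dK : IsDecomposable K := isDecomposable_res (hG.subset (subset_univ _))
      set N := {x ∈ W | G.Adj r x} with hNdef
      have hKr : ∀ x, K.Adj r x ↔ x ∈ N := fun x => by
        simp only [hK, res_adj, hNdef, mem_ofPred_eq, mem_insert_iff, true_or, true_and]
        refine ⟨fun h => ⟨h.2.resolve_left h.1.ne', h.1⟩, fun h => ⟨h.2, Or.inr h.1⟩⟩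
      have hNr : r ∉ N := fun h => hr h.1
      have hNK : K.IsClique N := fun x hx y hy hn => ⟨hN hx hy hn, Or.inr hx.1, Or.inr hy.1⟩
      have hW : res K {r}ᶜ = res G W := by
        ext x y
        simp only [hK, res_adj, mem_insert_iff, mem_compl_iff, mem_singleton_iff]
        have hx : x = r → x ∉ W := fun h => h ▸ hr
        have hy : y = r → y ∉ W := fun h => h ▸ hr
        tauto
      have hrN : ∀ D, N ⊆ D → r ∉ D → K.IsClique D → res K (insert r D) =
          completeOn (insert r N) ⊔ completeOn D := by
        intro D hND hrD hD
        ext x y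
        simp only [res_adj, SimpleGraph.sup_adj, completeOn_adj, mem_insert_iff]
        constructor
        · rintro ⟨hxy, hx, hy⟩
          have hn := hxy.ne
          rcases hx with rfl | hx
          · exact Or.inl ⟨hn, Or.inl rfl, Or.inr ((hKr y).1 hxy)⟩
          · rcases hy with rfl | hy
            · exact Or.inl ⟨hn, Or.inr ((hKr x).1 hxy.symm), Or.inl rfl⟩
            · exact Or.inr ⟨hn, hx, hy⟩
        · rintro (⟨hn, hx, hy⟩ | ⟨hn, hx, hy⟩)
          · refine ⟨?_, hx.imp_right (@hND x), hy.imp_right (@hND y)⟩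
            rcases hx with rfl | hx <;> rcases hy with rfl | hy
            · exact absurd rfl hn
            · exact (hKr y).2 hy
            · exact ((hKr x).2 hx).symm
            · exact hNK hx hy hn
          · exact ⟨hD hx hy hn, Or.inr hx, Or.inr hy⟩
      obtain ⟨D, hND, hD⟩ := exists_isMaxCliqueIn (G := K) (W := {r}ᶜ) hNK (by simpa using hNr)
      have hDK := hD.prop.1
      have hrD : r ∉ D := fun h => hD.prop.2 h rfl
      -- If N is maximal away from r, split along N with {r}ᶜ as the maximal side; r is cut off as
      -- the block N + r. Otherwise split along D with the side of r as the maximal one: r misses a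
      -- vertex of D, so D is maximal in D + r.
      by_cases hDN : D ⊆ N
      · obtain rfl : N = D := hND.antisymm hDN
        have hi : {r}ᶜ ∩ insert r N = N := by
          ext x
          have : x ∈ N → x ≠ r := fun h h' => hNr (h' ▸ h)
          simp only [mem_inter_iff, mem_compl_iff, mem_singleton_iff, mem_insert_iff]
          tauto
        have hw : IsWeakSplit K {r}ᶜ (insert r N) := by
          refine ⟨⟨by rwa [hi], ?_⟩, by rwa [hi]⟩
          intro a _ ha' b _ hb' hab
          rw [mem_compl_iff, mem_singleton_iff, not_not] at hb'
          subst hb'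
          exact ha' (Or.inr ((hKr a).1 hab.symm))
        have := hδ.add_completeOn (by ext x; simp; tauto) dK hw
        rwa [hi, hW, hrN N hND hrD hDK, h0, h2, ih, add_zero, add_zero] at this
      · obtain ⟨z, hzD, hzN⟩ := not_subset.1 hDN
        have hi : insert r D ∩ {r}ᶜ = D := by
          ext x
          have : x ∈ D → x ≠ r := fun h h' => hrD (h' ▸ h)
          simp only [mem_inter_iff, mem_compl_iff, mem_singleton_iff, mem_insert_iff]
          tauto
        have hw : IsWeakSplit K (insert r D) {r}ᶜ := by
          refine ⟨⟨by rwa [hi], ?_⟩, ?_⟩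
          · intro a _ ha' b _ hb' hab
            rw [mem_compl_iff, mem_singleton_iff, not_not] at ha'
            subst ha'
            exact hb' (Or.inr (hND ((hKr b).1 hab)))
          · rw [hi, isMaxCliqueIn_iff]
            refine ⟨hDK, subset_insert _ _, ?_⟩
            rintro x (rfl | hx) hxy
            · exact absurd ((hKr z).1 (hxy z hzD fun h => hrD (h ▸ hzD))) hzN
            · exact hx
        have := hδ.add_completeOn (by ext x; simp; tauto) dK hw
        rwa [hi, hW, hrN D hND hrD hDK, h0, h2, ih, add_zero, add_zero] at this
  convert key using 2
  ext x y
  simp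

/-- A swap-invariant function is, on decomposable graphs, a constant plus a clique sum. -/
lemma IsSwapInvariant.exists_eq_cliqueSum [Finite V] [Fintype (Set V)] (hf : IsSwapInvariant f) :
    ∃ (c : ℝ) (u v : Set V → ℝ), ∀ G, IsDecomposable G → f G = c + cliqueSum u v G univ := by
  classical
  let k : ℝ := f (completeOn ∅)
  -- The value of U S that makes the clique sum exact on K_{S+a} ∪ K_{S+b}.
  let g : Set V → V → V → ℝ := fun S a b => f (completeOn (insert a S)) +
    f (completeOn (insert b S)) - k - f (completeOn (insert a S) ⊔ completeOn (insert b S))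
  -- When S misses fewer than two vertices there is nothing to match. The default 0 still gives U ∅
  -- = 0 when V has at most one vertex.
  let U : Set V → ℝ := fun S =>
    if h : ∃ a b, a ∉ S ∧ b ∉ S ∧ a ≠ b then g S h.choose h.choose_spec.choose else 0
  have hU : ∀ S : Set V, (∃ a b, a ∉ S ∧ b ∉ S ∧ a ≠ b) →
      ∃ a b, a ∉ S ∧ b ∉ S ∧ a ≠ b ∧ U S = g S a b := by
    intro S h
    refine ⟨h.choose, h.choose_spec.choose, h.choose_spec.choose_spec.1,
      h.choose_spec.choose_spec.2.1, h.choose_spec.choose_spec.2.2, ?_⟩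
    simp only [U, dif_pos h]
  have hsub : ∀ S : Set V, S.Subsingleton → completeOn S = completeOn ∅ := by
    intro S hS
    ext x y
    simp only [completeOn_adj, mem_empty_iff_false, and_false, iff_false]
    exact fun h => h.1 (hS h.2.1 h.2.2)
  have hU0 : U ∅ = 0 := by
    by_cases h : ∃ a b : V, a ∉ (∅ : Set V) ∧ b ∉ (∅ : Set V) ∧ a ≠ b
    · obtain ⟨a, b, _, _, _, e⟩ := hU ∅ h
      rw [e]
      simp only [g, insert_empty_eq, hsub {a} subsingleton_singleton,
        hsub {b} subsingleton_singleton, sup_idem, k]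
      ring
    · simp only [U, dif_neg h]
  obtain ⟨u, hu⟩ := exists_subsetSum_eq U
  let v : Set V → ℝ := fun C => f (completeOn C) - k - U C
  have h0' : subsetSum u (∅ : Set V) = 0 := by rw [hu, hU0]
  have h1' : ∀ x : V, subsetSum u {x} + v {x} = 0 := by
    intro x
    simp only [hu, v, hsub {x} subsingleton_singleton, k]
    ring
  let δ : SimpleGraph V → ℝ := fun G => f G - k - cliqueSum u v G univ
  have hδ : IsSwapInvariant δ := by
    intro A B hc G H dG dH hG hH
    have e1 := hf A B hc G H dG dH hG hH
    have e2 := isSwapInvariant_cliqueSum (u := u) (v := v) A B hc G H dG dH hG hH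
    simp only [δ] at *
    linarith
  have hcl : ∀ C : Set V, (completeOn C).IsClique C := fun C x hx y hy hn => ⟨hn, hx, hy⟩
  have h0ne : ∀ C : Set V, C.Nonempty → δ (completeOn C) = 0 := by
    intro C hC
    simp only [δ]
    rw [cliqueSum_union_of_isolated h0' h1' hC fun x hx y (hxy : (completeOn C).Adj x y) => hx hxy.2.1,
      cliqueSum_of_isClique (hcl C), hu]
    simp only [v]
    ring
  have h0 : ∀ C, δ (completeOn C) = 0 := by
    intro C
    rcases C.eq_empty_or_nonempty with rfl | hC
    -- The removal of isolated vertices needs a nonempty block, so the edgeless graph is viewed as a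
    -- block on one vertex, unless V is empty.
    · rcases isEmpty_or_nonempty V with hV | ⟨⟨x⟩⟩
      · simp only [δ]
        rw [univ_eq_empty_iff.2 hV, cliqueSum_of_isClique (by simp), h0']
        simp only [v, hU0, k]
        ring
      · rw [← hsub {x} subsingleton_singleton]
        exact h0ne _ (singleton_nonempty x)
    · exact h0ne C hC
  refine ⟨k, u, v, fun G dG => ?_⟩
  have := hδ.eq_zero h0 (hδ.completeOn_sup_eq_zero h0 ?_) dG
  · simp only [δ] at this
    linarith
  · intro S hS
    obtain ⟨a, b, ha, hb, hab, e⟩ := hU S hS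
    refine ⟨a, b, ha, hb, hab, ?_⟩
    have hi : insert a S ∩ insert b S = S := by
      ext x
      have h1 : x = a → x ∉ S := fun h => h ▸ ha
      have h2 : x = a → x ≠ b := fun h => h ▸ hab
      simp only [mem_inter_iff, mem_insert_iff]
      tauto
    have hs := isSplit_completeOn_sup (C := insert a S) (D := insert b S)
    have e2 := hs.cliqueSum_union (u := u) (v := v)
    -- S is maximal in neither block, since a or b extends it; hence v S does not enter and only U S
    -- is subtracted.
    rw [hi, hu, if_neg, add_zero, e,
      cliqueSum_of_isClique (W := insert a S) fun x hx y hy hn => Or.inl ⟨hn, hx, hy⟩,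
      cliqueSum_of_isClique (W := insert b S) fun x hx y hy hn => Or.inr ⟨hn, hx, hy⟩,
      hu, hu] at e2
    · simp only [δ]
      rw [cliqueSum_union_of_isolated (W := insert a S ∪ insert b S) h0' h1' ⟨a, by simp⟩]
      · simp only [g, v] at e2
        linarith
      · rintro x hx y (h | h)
        exacts [hx (Or.inl h.2.1), hx (Or.inr h.2.1)]
    · rintro (h | h)
      · exact ha ((isMaxCliqueIn_iff.1 h).2.2 a (by simp) fun y hy hn =>
          Or.inl ⟨hn, by simp, Or.inr hy⟩)
      · exact hb ((isMaxCliqueIn_iff.1 h).2.2 b (by simp) fun y hy hn =>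
          Or.inr ⟨hn, by simp, Or.inr hy⟩)

end GraphLaw

/-! ### Conditional independence on a finite space as an exchange identity -/

namespace GraphLaw

open Set MeasureTheory

section FiniteProbability

open ProbabilityTheory

variable {Ω α β : Type*} [Finite Ω] [MeasurableSpace Ω] [MeasurableSingletonClass Ω]
  [Finite α] [MeasurableSpace α] [MeasurableSingletonClass α]
  [Finite β] [MeasurableSpace β] [MeasurableSingletonClass β]
  {P : Measure Ω}

lemma indepFun_iff_measureReal_singleton {f : Ω → α} {g : Ω → β} {μ : Measure Ω}
    [IsFiniteMeasure μ] : IndepFun f g μ ↔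
      ∀ a b, μ.real (f ⁻¹' {a} ∩ g ⁻¹' {b}) = μ.real (f ⁻¹' {a}) * μ.real (g ⁻¹' {b}) := by
  rw [indepFun_iff_map_prod_eq_prod_map_map (measurable_of_finite f).aemeasurable
    (measurable_of_finite g).aemeasurable, ext_iff_measureReal_singleton, Prod.forall]
  refine forall₂_congr fun a b => ?_
  rw [← singleton_prod_singleton, measureReal_prod_prod,
    map_measureReal_apply (measurable_of_finite f) (measurableSet_singleton a),
    map_measureReal_apply (measurable_of_finite g) (measurableSet_singleton b),
    map_measureReal_apply (measurable_of_finite _)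
      ((measurableSet_singleton a).prod (measurableSet_singleton b))]
  rfl

lemma cond_measureReal (E s : Set Ω) :
    (cond P E).real s = (P.real E)⁻¹ * P.real (E ∩ s) := by
  rw [measureReal_def, cond_apply (toFinite E).measurableSet, ENNReal.toReal_mul,
    ENNReal.toReal_inv, measureReal_def, measureReal_def]

/-- Through (f, g) the event E is a product set, and `gl x y` is its point with the first coordinate
of x and the second of y. Independence says that the density on E is a product, equivalently that
its two-by-two minors vanish. -/
lemma indepFun_cond_iff_exchange [IsProbabilityMeasure P] (hP : ∀ ω, 0 < P.real {ω}) {E : Set Ω} {f : Ω → α} {g : Ω → β}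
    {gl : Ω → Ω → Ω} (hgl : ∀ x ∈ E, ∀ y ∈ E, gl x y ∈ E)
    (hf : ∀ x ∈ E, ∀ y ∈ E, f (gl x y) = f x) (hg : ∀ x ∈ E, ∀ y ∈ E, g (gl x y) = g y)
    (hinj : ∀ x ∈ E, ∀ y ∈ E, f x = f y → g x = g y → x = y) :
    IndepFun f g (cond P E) ↔ ∀ x ∈ E, ∀ y ∈ E,
      P.real {x} * P.real {y} = P.real {gl x y} * P.real {gl y x} := by
  classical
  have := Fintype.ofFinite Ω
  rcases E.eq_empty_or_nonempty with rfl | ⟨z, hz⟩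
  · simp [indepFun_iff_measureReal_singleton]
  have hpE : 0 < P.real E :=
    (hP z).trans_le (measureReal_mono (singleton_subset_iff.2 hz))
  simp only [indepFun_iff_measureReal_singleton, cond_measureReal]
  constructor
  · intro h
    have key : ∀ x ∈ E, P.real {x} =
        (P.real E)⁻¹ * P.real (E ∩ f ⁻¹' {f x}) * P.real (E ∩ g ⁻¹' {g x}) := by
      intro x hx
      have e : E ∩ (f ⁻¹' {f x} ∩ g ⁻¹' {g x}) = {x} := by
        ext y
        refine ⟨fun hy => hinj y hy.1 x hx hy.2.1 hy.2.2, ?_⟩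
        rintro rfl
        exact ⟨hx, rfl, rfl⟩
      have := h (f x) (g x)
      rw [e] at this
      field_simp at this ⊢
      linarith
    intro x hx y hy
    rw [key x hx, key y hy, key _ (hgl x hx y hy), key _ (hgl y hy x hx), hf x hx y hy,
      hf y hy x hx, hg x hx y hy, hg y hy x hx]
    ring
  · intro h a b
    by_cases ha : ∃ x ∈ E, f x = a
    swap
    · have e : E ∩ f ⁻¹' {a} = ∅ := by
        ext x
        simp only [mem_inter_iff, mem_preimage, mem_singleton_iff, mem_empty_iff_false, iff_false]
        exact fun hx => ha ⟨x, hx⟩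
      rw [← inter_assoc, e]
      simp
    by_cases hb : ∃ x ∈ E, g x = b
    swap
    · have e : E ∩ g ⁻¹' {b} = ∅ := by
        ext x
        simp only [mem_inter_iff, mem_preimage, mem_singleton_iff, mem_empty_iff_false, iff_false]
        exact fun hx => hb ⟨x, hx⟩
      rw [inter_comm (f ⁻¹' {a}), ← inter_assoc, e]
      simp
    obtain ⟨x, hx, rfl⟩ := ha
    obtain ⟨y, hy, rfl⟩ := hb
    let k := gl x y
    have hk : k ∈ E := hgl x hx y hy
    have hfk : f k = f x := hf x hx y hy
    have hgk : g k = g y := hg x hx y hy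
    have e : E ∩ (f ⁻¹' {f x} ∩ g ⁻¹' {g y}) = {k} := by
      ext z
      refine ⟨fun hz => hinj z hz.1 k hk (hz.2.1.trans hfk.symm) (hz.2.2.trans hgk.symm), ?_⟩
      rintro rfl
      exact ⟨hk, hfk, hgk⟩
    have hsum : ∀ s : Set Ω, P.real s = ∑ z ∈ s.toFinset, P.real {z} := by
      intro s
      rw [sum_measureReal_singleton, coe_toFinset]
    -- Sum the exchange identity for k and m over m ∈ E: the points `gl k m` and `gl m k` range
    -- independently over the fibres of f and g through k.
    have main : P.real {k} * P.real E =
        P.real (E ∩ f ⁻¹' {f x}) * P.real (E ∩ g ⁻¹' {g y}) := by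
      rw [hsum E, hsum (E ∩ f ⁻¹' {f x}), hsum (E ∩ g ⁻¹' {g y}), Finset.sum_mul_sum,
        ← Finset.sum_product', Finset.mul_sum]
      refine Finset.sum_bij' (fun m _ => (gl k m, gl m k)) (fun q _ => gl q.2 q.1) ?_ ?_ ?_ ?_ ?_
      · intro m hm
        have hm : m ∈ E := by simpa using hm
        simp [hgl k hk m hm, hgl m hm k hk, hf k hk m hm, hg m hm k hk, hfk, hgk]
      · rintro ⟨p, q⟩ hpq
        simp only [Finset.mem_product, mem_toFinset, mem_inter_iff, mem_preimage,
          mem_singleton_iff] at hpq ⊢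
        exact hgl q hpq.2.1 p hpq.1.1
      · intro m hm
        have hm : m ∈ E := by simpa using hm
        have h1 := hgl k hk m hm
        have h2 := hgl m hm k hk
        refine hinj _ (hgl _ h2 _ h1) _ hm ?_ ?_
        · rw [hf _ h2 _ h1, hf m hm k hk]
        · rw [hg _ h2 _ h1, hg k hk m hm]
      · rintro ⟨p, q⟩ hpq
        simp only [Finset.mem_product, mem_toFinset, mem_inter_iff, mem_preimage,
          mem_singleton_iff] at hpq
        obtain ⟨⟨hp, hfp⟩, hq, hgq⟩ := hpq
        have h1 := hgl q hq p hp
        refine Prod.ext (hinj _ (hgl k hk _ h1) _ hp ?_ ?_) (hinj _ (hgl _ h1 k hk) _ hq ?_ ?_)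
        · rw [hf k hk _ h1, hfk, hfp]
        · rw [hg k hk _ h1, hg q hq p hp]
        · rw [hf _ h1 k hk, hf q hq p hp]
        · rw [hg _ h1 k hk, hgk, hgq]
      · intro m hm
        exact h k hk m (by simpa using hm)
    rw [e]
    field_simp
    linarith

end FiniteProbability

/-! ### Weak structural Markovianity as exchangeability of the log density -/

variable {V : Type*} {A B : Set V}

instance instMeasurableSingletonClassSimpleGraph [Finite V] :
    MeasurableSingletonClass (SimpleGraph V) := by
  refine ⟨fun G => ⟨{G.Adj}, measurableSet_singleton _, ?_⟩⟩
  ext H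
  simp [SimpleGraph.adj_inj]

lemma maximal_isClique_induce_iff (G : SimpleGraph V) :
    Maximal (G.induce A).IsClique {v : A | (v : V) ∈ B} ↔ IsMaxCliqueIn G A (A ∩ B) := by
  rw [← isMaxCliqueIn_univ, isMaxCliqueIn_iff, isMaxCliqueIn_iff,
    SimpleGraph.isClique_induce_iff]
  have e : (Subtype.val '' {v : A | (v : V) ∈ B}) = A ∩ B := by
    ext x
    simp [and_comm]
  rw [e]
  constructor
  · rintro ⟨h1, -, h3⟩
    exact ⟨h1, inter_subset_left, fun x hx hxy => ⟨hx, h3 ⟨x, hx⟩ (mem_univ _)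
      fun y hy hn => hxy y ⟨y.2, hy⟩ fun h => hn (Subtype.ext h)⟩⟩
  · rintro ⟨h1, -, h3⟩
    exact ⟨h1, subset_univ _, fun x _ hxy => (h3 x x.2
      fun y hy hn => hxy ⟨y, hy.1⟩ hy.2 fun h => hn (congrArg Subtype.val h)).2⟩

lemma mem_weakEvent_iff (hc : A ∪ B = univ) (G : DecomposableGraph V) :
    G ∈ weakEvent A B ↔ IsWeakSplit G.1 A B := by
  change IsDecompositionOf G.1 univ A B ∧ _ ↔ _
  rw [maximal_isClique_induce_iff]
  exact ⟨fun h => ⟨isSplit_of_isDecompositionOf h.1, h.2⟩,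
    fun h => ⟨hc ▸ h.toIsSplit.isDecompositionOf, h.maximal⟩⟩

lemma induce_eq_induce_iff {G H : SimpleGraph V} :
    G.induce A = H.induce A ↔ ∀ x ∈ A, ∀ y ∈ A, G.Adj x y ↔ H.Adj x y := by
  constructor
  · intro h x hx y hy
    simpa using congrArg (fun K : SimpleGraph A => K.Adj ⟨x, hx⟩ ⟨y, hy⟩) h
  · intro h
    ext x y
    exact h x x.2 y y.2

/-- The logarithm of the probability of a graph. -/
noncomputable def logDensity (P : Measure (DecomposableGraph V)) (G : SimpleGraph V) : ℝ :=
  Real.log (P.real {H | H.1 = G})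

lemma logDensity_coe (P : Measure (DecomposableGraph V)) (G : DecomposableGraph V) :
    logDensity P G.1 = Real.log (P.real {G}) := by
  have : {H : DecomposableGraph V | H.1 = G.1} = {G} := by
    ext H
    exact Subtype.ext_iff.symm
  rw [logDensity, this]

/-- For a law of full support, weak structural Markovianity is the exchange property. -/
lemma isWeaklyStructurallyMarkov_iff [Finite V] (P : Measure (DecomposableGraph V))
    [IsProbabilityMeasure P] (hP : ∀ G, 0 < P.real {G}) :
    IsWeaklyStructurallyMarkov P ↔ IsSwapInvariant (logDensity P) := by
  classical
  refine forall₃_congr fun A B hc => ?_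
  -- Gluing must be a total map on decomposable graphs; the value G is never used on the event,
  -- where A ∩ B is complete in both graphs.
  let gl : DecomposableGraph V → DecomposableGraph V → DecomposableGraph V := fun G H =>
    if h : G.1.IsClique (A ∩ B) ∧ H.1.IsClique (A ∩ B) then
      ⟨glue A B G.1 H.1, isDecomposable_glue hc h.1 h.2 G.2 H.2⟩ else G
  have hgl : ∀ G H : DecomposableGraph V, IsWeakSplit G.1 A B → IsWeakSplit H.1 A B →
      (gl G H).1 = glue A B G.1 H.1 := by
    intro G H hG hH
    simp only [gl, dif_pos (And.intro hG.complete hH.complete)]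
  rw [indepFun_cond_iff_exchange hP (gl := gl)]
  · simp only [mem_weakEvent_iff hc, Subtype.forall]
    constructor
    · intro h G H dG dH hG hH
      have := congrArg Real.log (h G dG hG H dH hH)
      rw [Real.log_mul (hP _).ne' (hP _).ne', Real.log_mul (hP _).ne' (hP _).ne',
        ← logDensity_coe, ← logDensity_coe, ← logDensity_coe, ← logDensity_coe, hgl _ _ hG hH,
        hgl _ _ hH hG] at this
      exact this
    · intro h G dG hG H dH hH
      have := h G H dG dH hG hH
      rw [← hgl ⟨G, dG⟩ ⟨H, dH⟩ hG hH, ← hgl ⟨H, dH⟩ ⟨G, dG⟩ hH hG, logDensity_coe, logDensity_coe,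
        logDensity_coe P ⟨G, dG⟩, logDensity_coe P ⟨H, dH⟩,
        ← Real.log_mul (hP _).ne' (hP _).ne', ← Real.log_mul (hP _).ne' (hP _).ne'] at this
      exact Real.log_injOn_pos (mul_pos (hP _) (hP _)) (mul_pos (hP _) (hP _)) this
  · intro G hG H hH
    rw [mem_weakEvent_iff hc] at *
    rw [hgl G H hG hH]
    exact hG.glue
  · intro G hG H hH
    rw [mem_weakEvent_iff hc] at *
    rw [hgl G H hG hH]
    exact induce_eq_induce_iff.2 fun x hx y hy => glue_adj_left hG.complete hx hy
  · intro G hG H hH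
    rw [mem_weakEvent_iff hc] at *
    rw [hgl G H hG hH]
    exact induce_eq_induce_iff.2 fun x hx y hy => glue_adj_right hH.complete hx hy
  · intro G hG H hH hA hB
    rw [mem_weakEvent_iff hc] at *
    exact Subtype.ext (hG.toIsSplit.eq_of_forall_adj hc hH.toIsSplit
      (induce_eq_induce_iff.1 hA) (induce_eq_induce_iff.1 hB))

end GraphLaw

/-! ### Clique sums read off a junction tree -/

namespace GraphLaw

open Set

variable {V : Type*} {G : SimpleGraph V} {W X : Set V}

lemma subset_linkSeparator_iff {e : Sym2 (MaxClique G)} :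
    X ⊆ linkSeparator e ↔ ∀ C ∈ e, X ⊆ C.1 := by
  induction e with
  | h C D => simp [linkSeparator]

-- The cliques containing X induce a subtree, nonempty because X is complete, and its edges are the
-- links whose separator contains X. A finite tree has one more vertex than edges.
open Classical in
lemma IsJunctionTree.card_cliques_eq [Finite V] {T : SimpleGraph (MaxClique G)}
    (hT : IsJunctionTree G T) (hX : G.IsClique X) :
    (Finset.univ.filter fun C : MaxClique G => X ⊆ C.1).card =
      (T.edgeSet.toFinite.toFinset.filter fun e => X ⊆ linkSeparator e).card + 1 := by
  let s : Set (MaxClique G) := {C | X ⊆ C.1}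
  obtain ⟨D, hXD, hD⟩ := exists_isMaxCliqueIn hX (subset_univ X)
  have hs : (T.induce s).IsTree :=
    { preconnected := hT.connected X
      nonempty := ⟨⟨⟨D, isMaxCliqueIn_univ.1 hD⟩, hXD⟩⟩
      isAcyclic := hT.isTree.isAcyclic.induce s }
  have h1 := hs.card_edgeFinset
  have h2 : Fintype.card s = (Finset.univ.filter fun C : MaxClique G => X ⊆ C.1).card :=
    Fintype.card_subtype _
  rw [← h2, ← h1]
  congr 1
  refine Finset.card_bij (fun e _ => Sym2.map Subtype.val e) ?_ ?_ ?_
  · intro e he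
    induction e with
    | h C D =>
      simp only [SimpleGraph.mem_edgeFinset, SimpleGraph.mem_edgeSet, SimpleGraph.comap_adj,
        Function.Embedding.subtype_apply] at he
      simp only [Finset.mem_filter, Finite.mem_toFinset, Sym2.map_mk, SimpleGraph.mem_edgeSet,
        subset_linkSeparator_iff, Sym2.mem_iff, forall_eq_or_imp, forall_eq]
      exact ⟨he, C.2, D.2⟩
  · intro e _ e' _ h
    exact Sym2.map.injective Subtype.val_injective h
  · intro e he
    induction e with
    | h C D =>
      simp only [Finset.mem_filter, Finite.mem_toFinset, SimpleGraph.mem_edgeSet,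
        subset_linkSeparator_iff, Sym2.mem_iff, forall_eq_or_imp, forall_eq] at he
      exact ⟨s(⟨C, he.2.1⟩, ⟨D, he.2.2⟩), by simpa using he.1, rfl⟩

/-- Exchange the order of summation: each u X is counted once per clique and minus once per
separator containing X, in total once if X is complete and never otherwise. -/
lemma IsJunctionTree.cliqueSum_eq [Finite V] [Fintype (Set V)] {T : SimpleGraph (MaxClique G)}
    (hT : IsJunctionTree G T) (u v : Set V → ℝ) :
    cliqueSum u v G univ = ∑ C : MaxClique G, (subsetSum u C.1 + v C.1) -
      ((separators T).map (subsetSum u)).sum := by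
  classical
  have e1 : ∑ C : MaxClique G, v C.1 = ∑ X, if IsMaxCliqueIn G univ X then v X else 0 := by
    rw [← Finset.sum_filter]
    refine (Finset.sum_subtype (p := fun C => Maximal G.IsClique C) _ (fun X => ?_) _).symm
    simp [isMaxCliqueIn_univ]
  have e2 : ((separators T).map (subsetSum u)).sum =
      ∑ e ∈ T.edgeSet.toFinite.toFinset, subsetSum u (linkSeparator e) := by
    rw [separators, Multiset.map_map]
    rfl
  have e3 : ∑ X, (if G.IsClique X ∧ X ⊆ univ then u X else 0) =
      ∑ C : MaxClique G, subsetSum u C.1 -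
        ∑ e ∈ T.edgeSet.toFinite.toFinset, subsetSum u (linkSeparator e) := by
    simp only [subsetSum]
    rw [Finset.sum_comm, Finset.sum_comm (s := T.edgeSet.toFinite.toFinset),
      ← Finset.sum_sub_distrib]
    refine Finset.sum_congr rfl fun X _ => ?_
    simp only [← Finset.sum_filter, Finset.sum_const, nsmul_eq_mul]
    by_cases hX : G.IsClique X
    · rw [hT.card_cliques_eq hX]
      simp only [hX, subset_univ, and_self, if_true]
      push_cast
      ring
    · have hC : ∀ C : MaxClique G, ¬X ⊆ C.1 := fun C h => hX (C.2.prop.subset h)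
      have he : ∀ e : Sym2 (MaxClique G), ¬X ⊆ linkSeparator e := fun e h =>
        hC _ (subset_linkSeparator_iff.1 h e.out.1 (Sym2.out_fst_mem e))
      simp [hX, hC, he]
  rw [cliqueSum, Finset.sum_add_distrib, e3, ← e1, e2, Finset.sum_add_distrib]
  ring

lemma IsJunctionTree.log_eq [Finite V] [Fintype (Set V)] {T : SimpleGraph (MaxClique G)}
    (hT : IsJunctionTree G T) {φ ψ u v : Set V → ℝ} (hφ : ∀ A, 0 < φ A) (hψ : ∀ A, 0 < ψ A)
    (hu : ∀ A, subsetSum u A = Real.log (ψ A))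
    (hv : ∀ A, subsetSum u A + v A = Real.log (φ A)) :
    Real.log ((∏ C : MaxClique G, φ C.1) / ((separators T).map ψ).prod) =
      cliqueSum u v G univ := by
  have e : ((separators T).map ψ).prod =
      ∏ e ∈ T.edgeSet.toFinite.toFinset, ψ (linkSeparator e) := by
    rw [separators, Multiset.map_map]
    rfl
  have e2 : ((separators T).map (subsetSum u)).sum =
      ∑ e ∈ T.edgeSet.toFinite.toFinset, subsetSum u (linkSeparator e) := by
    rw [separators, Multiset.map_map]
    rfl
  rw [hT.cliqueSum_eq, e, e2, Real.log_div (Finset.prod_pos fun _ _ => hφ _).ne'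
    (Finset.prod_pos fun _ _ => hψ _).ne', Real.log_prod fun _ _ => (hφ _).ne',
    Real.log_prod fun _ _ => (hψ _).ne']
  simp only [hu, ← hv]

/-! ### Existence of junction trees -/

section Existence

/-- A tree on labels `K : ι → Set V` running bijectively through the cliques of `G_W`, with the
junction property. -/
structure IsLabelledJunctionTree (G : SimpleGraph V) (W : Set V) {ι : Type} (K : ι → Set V)
    (T : SimpleGraph ι) : Prop where
  injective : Function.Injective K
  isMaxCliqueIn_iff : ∀ C, IsMaxCliqueIn G W C ↔ C ∈ range K
  isTree : T.IsTree
  connected : ∀ A : Set V, (T.induce {i | A ⊆ K i}).Preconnected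

/-- `T` with a new leaf attached at `i`. -/
def addLeaf {ι : Type*} (T : SimpleGraph ι) (i : ι) : SimpleGraph (Option ι) :=
  T.map some ⊔ SimpleGraph.edge none (some i)

lemma addLeaf_induce_preconnected {ι : Type*} {T : SimpleGraph ι} {i : ι} {s : Set (Option ι)}
    (h : (T.induce {j | some j ∈ s}).Preconnected)
    (hs : none ∈ s → ∀ j, some j ∈ s → some i ∈ s) : ((addLeaf T i).induce s).Preconnected := by
  have h1 : ∀ (j k : ι) (hj : some j ∈ s) (hk : some k ∈ s),
      ((addLeaf T i).induce s).Reachable ⟨some j, hj⟩ ⟨some k, hk⟩ := by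
    intro j k hj hk
    let F : T.induce {j | some j ∈ s} →g (addLeaf T i).induce s :=
      { toFun := fun j => ⟨some j.1, j.2⟩
        map_rel' := fun {a b} hab => Or.inl
          ⟨fun e => hab.ne (Subtype.ext (Option.some_injective _ e)), a.1, b.1, hab, rfl, rfl⟩ }
    exact (h ⟨j, hj⟩ ⟨k, hk⟩).map F
  have h2 : ∀ (k : ι) (h0 : none ∈ s) (hk : some k ∈ s),
      ((addLeaf T i).induce s).Reachable ⟨none, h0⟩ ⟨some k, hk⟩ := by
    intro k h0 hk
    have hi := hs h0 k hk
    refine SimpleGraph.Reachable.trans (SimpleGraph.Adj.reachable ?_) (h1 i k hi hk)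
    exact Or.inr (by simp [SimpleGraph.edge_adj])
  rintro ⟨_ | j, hj⟩ ⟨_ | k, hk⟩
  · exact SimpleGraph.Reachable.refl _
  · exact h2 k hj hk
  · exact (h2 j hk hj).symm
  · exact h1 j k hj hk

lemma preconnected_of_induce_univ {ι : Type*} {T : SimpleGraph ι}
    (h : (T.induce univ).Preconnected) : T.Preconnected :=
  h.map (SimpleGraph.induceUnivIso T).toHom (SimpleGraph.induceUnivIso T).surjective

/-- The new graph is connected and has at most one more edge than T, so the edge count of a tree is
forced. -/
lemma isTree_addLeaf {ι : Type*} [Finite ι] {T : SimpleGraph ι} (hT : T.IsTree) (i : ι) :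
    (addLeaf T i).IsTree := by
  have hc : (addLeaf T i).Connected := by
    have : Nonempty (Option ι) := ⟨none⟩
    refine ⟨preconnected_of_induce_univ (addLeaf_induce_preconnected ?_ fun _ _ _ => mem_univ _)⟩
    exact hT.preconnected.map (SimpleGraph.induceUnivIso T).symm.toHom
      (SimpleGraph.induceUnivIso T).symm.surjective
  refine SimpleGraph.isTree_iff_connected_and_card.2 ⟨hc, ?_⟩
  refine le_antisymm ?_ hc.card_vert_le_card_edgeSet_add_one
  have h1 := (SimpleGraph.isTree_iff_connected_and_card.1 hT).2
  have h2 : (addLeaf T i).edgeSet ⊆ insert s(none, some i) (Sym2.map some '' T.edgeSet) := by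
    intro e he
    induction e with
    | h a b =>
      rcases he with he | he
      · obtain ⟨_, a', b', hab, rfl, rfl⟩ := he
        exact Or.inr ⟨s(a', b'), hab, rfl⟩
      · refine Or.inl ?_
        rw [SimpleGraph.edge_adj] at he
        rw [Sym2.eq_iff]
        tauto
  have h3 := ncard_le_ncard h2 (toFinite _)
  have h4 := ncard_insert_le s(none, some i) (Sym2.map some '' T.edgeSet)
  have h5 := ncard_image_le (f := Sym2.map some) (toFinite T.edgeSet)
  rw [Nat.card_coe_set_eq] at *
  rw [Finite.card_option]
  omega

/-- Apply the split of the enlarged graph into W and r with its neighbours N; they meet in N, which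
the clique N + r absorbs. -/
lemma isMaxCliqueIn_insert_iff {r : V} (hr : r ∉ W) (hN : G.IsClique {x ∈ W | G.Adj r x}) :
    IsMaxCliqueIn G (insert r W) X ↔ X ≠ {x ∈ W | G.Adj r x} ∧
      (IsMaxCliqueIn G W X ∨ X = insert r {x ∈ W | G.Adj r x}) := by
  set N := {x ∈ W | G.Adj r x}
  have hNW : N ⊆ W := sep_subset _ _
  have hrN : r ∉ N := fun h => hr h.1
  have hB : G.IsClique (insert r N) := hN.insert fun y hy _ => hy.2
  have hi : W ∩ insert r N = N := by
    rw [inter_insert_of_notMem hr, inter_eq_right.2 hNW]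
  have hU : W ∪ insert r N = insert r W := by
    rw [union_insert, union_eq_left.2 hNW]
  have hs : IsSplit G W (insert r N) := by
    refine ⟨by rwa [hi], ?_⟩
    rintro a ha ha' b (rfl | hb) hb' hab
    · exact ha' (Or.inr ⟨ha, hab.symm⟩)
    · exact hb' hb.1
  rw [← hU]
  by_cases hX : X = N
  · subst hX
    have := hs.isMaxCliqueIn_union_inter_iff
    rw [hi, isMaxCliqueIn_iff_eq_of_isClique hB] at this
    rw [this]
    have hne : N ≠ insert r N := fun h => hrN (h ▸ mem_insert r N)
    tauto
  · rw [hs.isMaxCliqueIn_union_iff_of_ne (by rwa [hi]), isMaxCliqueIn_iff_eq_of_isClique hB]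
    tauto

/-- The case where N is already a clique: N + r takes over its node. A set avoiding r lies in N + r
exactly when it lies in N, and a set containing r lies in no other label. -/
lemma IsLabelledJunctionTree.update {ι : Type} [DecidableEq ι] {K : ι → Set V} {T : SimpleGraph ι}
    (h : IsLabelledJunctionTree G W K T) {r : V} (hr : r ∉ W)
    (hN : G.IsClique {x ∈ W | G.Adj r x}) {i : ι} (hi : K i = {x ∈ W | G.Adj r x}) :
    IsLabelledJunctionTree G (insert r W)
      (Function.update K i (insert r {x ∈ W | G.Adj r x})) T := by
  have hr' : ∀ j, r ∉ K j := fun j hj => hr (((h.isMaxCliqueIn_iff _).2 ⟨j, rfl⟩).prop.2 hj)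
  refine ⟨?_, ?_, h.isTree, ?_⟩
  · intro j k hjk
    by_cases hj : j = i <;> by_cases hk : k = i
    · rw [hj, hk]
    · subst hj
      rw [Function.update_self, Function.update_of_ne hk] at hjk
      exact absurd (hjk ▸ mem_insert r _) (hr' k)
    · subst hk
      rw [Function.update_self, Function.update_of_ne hj] at hjk
      exact absurd (hjk.symm ▸ mem_insert r _) (hr' j)
    · rw [Function.update_of_ne hk, Function.update_of_ne hj] at hjk
      exact h.injective hjk
  · intro C
    rw [isMaxCliqueIn_insert_iff hr hN, h.isMaxCliqueIn_iff, ← hi]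
    constructor
    · rintro ⟨hC, ⟨j, rfl⟩ | rfl⟩
      · exact ⟨j, Function.update_of_ne (fun e => hC (congrArg K e)) _ _⟩
      · exact ⟨i, Function.update_self _ _ _⟩
    · rintro ⟨j, rfl⟩
      by_cases hj : j = i
      · subst hj
        rw [Function.update_self]
        exact ⟨fun e => hr' j (e ▸ mem_insert r _), Or.inr rfl⟩
      · rw [Function.update_of_ne hj]
        exact ⟨fun e => hj (h.injective e), Or.inl ⟨j, rfl⟩⟩
  · intro A
    by_cases hA : r ∈ A
    · have : ∀ j : {j | A ⊆ Function.update K i (insert r {x ∈ W | G.Adj r x}) j}, j.1 = i := by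
        intro j
        by_contra hj
        have := j.2 hA
        rw [Function.update_of_ne hj] at this
        exact hr' _ this
      intro j k
      rw [Subtype.ext ((this j).trans (this k).symm)]
    · have : {j | A ⊆ Function.update K i (insert r {x ∈ W | G.Adj r x}) j} = {j | A ⊆ K j} := by
        ext j
        by_cases hj : j = i
        · subst hj
          change A ⊆ Function.update K j _ j ↔ A ⊆ K j
          rw [Function.update_self, hi, subset_insert_iff_of_notMem hA]
        · change A ⊆ Function.update K i _ j ↔ A ⊆ K j
          rw [Function.update_of_ne hj]
      rw [this]
      exact h.connected A

/-- The case where N is not a clique: N + r becomes a leaf at a clique containing N. A set avoiding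
r that lies in the leaf also lies in its neighbour, so connectedness persists. -/
lemma IsLabelledJunctionTree.addLeaf {ι : Type} [Finite ι] {K : ι → Set V} {T : SimpleGraph ι}
    (h : IsLabelledJunctionTree G W K T) {r : V} (hr : r ∉ W)
    (hN : G.IsClique {x ∈ W | G.Adj r x}) {i : ι} (hi : {x ∈ W | G.Adj r x} ⊆ K i)
    (hmax : ¬IsMaxCliqueIn G W {x ∈ W | G.Adj r x}) :
    IsLabelledJunctionTree G (insert r W)
      (fun o => o.elim (insert r {x ∈ W | G.Adj r x}) K) (addLeaf T i) := by
  have hr' : ∀ j, r ∉ K j := fun j hj => hr (((h.isMaxCliqueIn_iff _).2 ⟨j, rfl⟩).prop.2 hj)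
  refine ⟨?_, ?_, isTree_addLeaf h.isTree i, ?_⟩
  · rintro (_ | j) (_ | k) hjk
    · rfl
    · have e : insert r {x ∈ W | G.Adj r x} = K k := hjk
      exact absurd (e ▸ mem_insert r _) (hr' k)
    · have e : K j = insert r {x ∈ W | G.Adj r x} := hjk
      exact absurd (e ▸ mem_insert r _) (hr' j)
    · exact congrArg some (h.injective hjk)
  · intro C
    rw [isMaxCliqueIn_insert_iff hr hN]
    constructor
    · rintro ⟨hC, hC' | rfl⟩
      · obtain ⟨j, rfl⟩ := (h.isMaxCliqueIn_iff C).1 hC'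
        exact ⟨some j, rfl⟩
      · exact ⟨none, rfl⟩
    · rintro ⟨_ | j, rfl⟩
      · exact ⟨fun e => hr (e ▸ mem_insert r _ : r ∈ {x ∈ W | G.Adj r x}).1, Or.inr rfl⟩
      · have hj := (h.isMaxCliqueIn_iff (K j)).2 ⟨j, rfl⟩
        exact ⟨fun e => hmax (e ▸ hj), Or.inl hj⟩
  · intro A
    by_cases hA : r ∈ A
    · rintro ⟨_ | j, hj⟩ ⟨_ | k, hk⟩
      · rfl
      · exact absurd (hk hA) (hr' k)
      · exact absurd (hj hA) (hr' j)
      · exact absurd (hj hA) (hr' j)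
    · refine addLeaf_induce_preconnected (h.connected A) fun h0 j _ => ?_
      exact ((subset_insert_iff_of_notMem hA).1 h0).trans hi

lemma IsDecomposableOn.exists_isLabelledJunctionTree [Finite V] (h : IsDecomposableOn G W) :
    ∃ (ι : Type) (_ : Finite ι) (K : ι → Set V) (T : SimpleGraph ι),
      IsLabelledJunctionTree G W K T := by
  classical
  refine h.elimination_induction (motive := fun W => ∃ (ι : Type) (_ : Finite ι) (K : ι → Set V)
    (T : SimpleGraph ι), IsLabelledJunctionTree G W K T) ?_ ?_
  · refine ⟨Unit, inferInstance, fun _ => ∅, ⊥, Function.injective_of_subsingleton _, ?_,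
      SimpleGraph.IsTree.of_subsingleton, fun A j k => ?_⟩
    · intro C
      rw [isMaxCliqueIn_iff_eq_of_isClique (by simp)]
      simp
    · rw [Subsingleton.elim j k]
  · rintro W r hr hN ⟨ι, _, K, T, hT⟩
    by_cases hmax : IsMaxCliqueIn G W {x ∈ W | G.Adj r x}
    · obtain ⟨i, hi⟩ := (hT.isMaxCliqueIn_iff _).1 hmax
      exact ⟨ι, inferInstance, _, T, hT.update hr hN hi⟩
    · obtain ⟨D, hND, hD⟩ := exists_isMaxCliqueIn (W := W) hN (sep_subset _ _)
      obtain ⟨i, rfl⟩ := (hT.isMaxCliqueIn_iff _).1 hD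
      exact ⟨Option ι, inferInstance, _, _, hT.addLeaf hr hN hND hmax⟩

/-- Every decomposable graph has a junction tree. -/
lemma IsDecomposable.exists_isJunctionTree [Finite V] (h : IsDecomposable G) :
    ∃ T : SimpleGraph (MaxClique G), IsJunctionTree G T := by
  obtain ⟨ι, _, K, T, hT⟩ := IsDecomposableOn.exists_isLabelledJunctionTree h
  have hK : ∀ i, Maximal G.IsClique (K i) := fun i =>
    isMaxCliqueIn_univ.1 ((hT.isMaxCliqueIn_iff _).2 ⟨i, rfl⟩)
  let e : ι ≃ MaxClique G := Equiv.ofBijective (fun i => ⟨K i, hK i⟩) <| by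
    refine ⟨fun i j hij => hT.injective (congrArg Subtype.val hij), fun C => ?_⟩
    obtain ⟨i, hi⟩ := (hT.isMaxCliqueIn_iff C.1).1 (isMaxCliqueIn_univ.2 C.2)
    exact ⟨i, Subtype.ext hi⟩
  have he : ∀ i, (e i).1 = K i := fun i => rfl
  refine ⟨T.comap e.symm, (SimpleGraph.Iso.comap e.symm T).isTree_iff.2 hT.isTree, fun A => ?_⟩
  let F : T.induce {i | A ⊆ K i} →g (T.comap e.symm).induce {C : MaxClique G | A ⊆ C.1} :=
    { toFun := fun i => ⟨e i.1, i.2⟩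
      map_rel' := fun {a b} hab => by simpa using hab }
  refine (hT.connected A).map F ?_
  rintro ⟨C, hC⟩
  obtain ⟨i, rfl⟩ := e.surjective C
  exact ⟨⟨i, hC⟩, rfl⟩

end Existence

end GraphLaw

/-! ### The equivalence -/

open GraphLaw in
/-- A graph law on the decomposable graphs on `V` with full support is weakly structurally Markov if
and only if it is a clique--separator factorisation law. -/
theorem theorem1 {V : Type*} [Finite V]
    (P : MeasureTheory.Measure (GraphLaw.DecomposableGraph V))
    [MeasureTheory.IsProbabilityMeasure P]
    (hP : ∀ G : GraphLaw.DecomposableGraph V, 0 < P {G}) :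
    GraphLaw.IsWeaklyStructurallyMarkov P ↔ GraphLaw.IsCliqueSeparatorFactorisationLaw P := by
  have := Fintype.ofFinite (Set V)
  have hp : ∀ G, 0 < P.real {G} := fun G =>
    ENNReal.toReal_pos (hP G).ne' (MeasureTheory.measure_ne_top P _)
  rw [isWeaklyStructurallyMarkov_iff P hp]
  constructor
  · intro h
    obtain ⟨c, u, v, huv⟩ := h.exists_eq_cliqueSum
    refine ⟨fun A => Real.exp (subsetSum u A + v A), fun A => Real.exp (subsetSum u A),
      fun A => Real.exp_pos _, fun A => Real.exp_pos _, Real.exp c, Real.exp_pos c, ?_⟩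
    intro G T hT
    have hl := hT.log_eq (φ := fun A => Real.exp (subsetSum u A + v A))
      (ψ := fun A => Real.exp (subsetSum u A)) (u := u) (v := v) (fun A => Real.exp_pos _)
      (fun A => Real.exp_pos _) (fun A => (Real.log_exp _).symm) (fun A => (Real.log_exp _).symm)
    have hR := div_pos (Finset.prod_pos fun (C : MaxClique G.1) (_ : C ∈ Finset.univ) =>
      Real.exp_pos (subsetSum u C.1 + v C.1)) (Multiset.prod_pos (s := (separators T).map
        fun A => Real.exp (subsetSum u A)) (by simp [Real.exp_pos]))
    refine Real.log_injOn_pos (hp G) (mul_pos (Real.exp_pos c) hR) ?_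
    rw [Real.log_mul (Real.exp_pos c).ne' hR.ne', Real.log_exp, hl, ← huv G.1 G.2, logDensity_coe]
  · rintro ⟨φ, ψ, hφ, hψ, c, hc, h⟩
    obtain ⟨u, hu⟩ := exists_subsetSum_eq fun A => Real.log (ψ A)
    let v : Set V → ℝ := fun A => Real.log (φ A) - Real.log (ψ A)
    have key : ∀ G, IsDecomposable G → logDensity P G = Real.log c + cliqueSum u v G Set.univ := by
      intro G dG
      -- The factorisation is assumed only relative to a junction tree, so one has to exist before
      -- it says anything about G.
      obtain ⟨T, hT⟩ := dG.exists_isJunctionTree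
      have hR := div_pos (Finset.prod_pos fun (C : MaxClique G) (_ : C ∈ Finset.univ) => hφ C.1)
        (Multiset.prod_pos (s := (separators T).map ψ) (by simp [hψ]))
      rw [logDensity_coe P ⟨G, dG⟩, h ⟨G, dG⟩ T hT, Real.log_mul hc.ne' hR.ne',
        hT.log_eq hφ hψ hu (v := v) fun A => by simp [v, hu]]
    intro A B hAB G H dG dH hG hH
    have := isSwapInvariant_cliqueSum (u := u) (v := v) A B hAB G H dG dH hG hH
    rw [key G dG, key H dH, key _ (isDecomposable_glue hAB hG.complete hH.complete dG dH),
      key _ (isDecomposable_glue hAB hH.complete hG.complete dH dG)]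
    dsimp only at this
    linarith
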